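/- Let $Q$ be a conjunctive query with a finite set $V$ of variables, multi-hypergraph $\mathcal H=(V,\mathcal E)$, and a finite set $\mathsf{DC}$ of degree constraints $(X,Y,N_{Y|X})$, where $X\subsetneq Y\subseteq V$, $N_{Y|X}\in\mathbb N\cup\{\infty\}$, and each $Y$ is contained in some $F\in\mathcal E$. Let $\mathsf{HDC}$ be the set of all $h:2^{V}\to\mathbb R$ with $h(Y)-h(X)\le\log_2 N_{Y|X}$ for all $(X,Y,N_{Y|X})\in\mathsf{DC}$; let $\Gamma$ be the set of nonnegative monotone submodular $h:2^V\to\mathbb R$ with $h(\emptyset)=0$; let $\Gamma^*$ be the set of entropic functions, i.e. $h(S)=H(A_S)$ (entropy in bits) for jointly distributed discrete random variables $(A_v)_{v\in V}$; and let $\overline{\Gamma^*}$ be its topological closure. For a class $\mathcal F$ of set functions put, with $(T,\chi)$ ranging over the tree decompositions of $\mathcal H$ and extrema taken in $[-\infty,\infty]$, $$\mathsf{Minimax}_{\mathcal F}(Q)=\min_{(T,\chi)}\max_{t\in V(T)}\sup_{h\in\mathcal F}h(\chi(t)),\qquad \mathsf{Maximin}_{\mathcal F}(Q)=\sup_{h\in\mathcal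 F}\min_{(T,\chi)}\max_{t\in V(T)}h(\chi(t)),$$ and define $\text{da-fhtw}=\mathsf{Minimax}_{\Gamma\cap\mathsf{HDC}}$, $\text{da-subw}=\mathsf{Maximin}_{\Gamma\cap\mathsf{HDC}}$, $\text{eda-fhtw}=\mathsf{Minimax}_{\overline{\Gamma^*}\cap\mathsf{HDC}}$, $\text{eda-subw}=\mathsf{Maximin}_{\overline{\Gamma^*}\cap\mathsf{HDC}}$. Then: 1. For every such query $Q$, $\text{eda-subw}(Q)\le\text{eda-fhtw}(Q)\le\text{da-fhtw}(Q)$ and $\text{eda-subw}(Q)\le\text{da-subw}(Q)\le\text{da-fhtw}(Q)$. 2. $\text{eda-fhtw}$ and $\text{da-subw}$ are incomparable. For the 4-cycle query $C_4$ with atoms $R_{12}(A_1,A_2),R_{23}(A_2,A_3),R_{34}(A_3,A_4),R_{41}(A_4,A_1)$ and cardinality constraints $|R_{ij}|\le N$, where $N\ge 2$, one has $\text{eda-fhtw}(C_4)=2\log_2 N>\tfrac32\log_2 N=\text{da-subw}(C_4)$. For the augmented Zhang–Yeung query $\mathsf{ZY}^+$ with atoms $K(A,B,X,Y,C)$, $R(X,Y)$,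 $S(A,X)$, $T(A,Y)$, $U(B,X)$, $V(B,Y)$, $W(C)$ and $R'(A,B,X,Y,C)$, cardinality constraints $|R|,|S|,|T|,|U|,|V|\le N^3$, $|W|\le N^2$, $|R'|\le M$, and keys $AB,AXY,BXY,AC,XC,YC$ of $K$ (each key determines all five variables), where $N\ge2$ and $N^4\le M\le\infty$, one has $\text{eda-fhtw}(\mathsf{ZY}^+)<\text{da-subw}(\mathsf{ZY}^+)$. 3. Each of the four gaps in part 1 can be made arbitrarily large, even with bounded input sizes: there is a fixed $N\in\mathbb N$ such that for every real $C$ and each of the four inequalities in part 1 there is a query $Q$, all of whose finite degree bounds are at most $N$, for which both sides of that inequality are finite and the right-hand side exceeds the left-hand side by at least $C$. -/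

import Mathlib

namespace DegreeAware

/-! ### Queries with degree constraints -/

/-- A degree constraint `(X, Y, N_{Y|X})` with `X ⊂ Y ⊆ V` and `N_{Y|X} ∈ ℕ ∪ {∞}`. -/
structure DegreeConstraint (V : Type*) where
  src : Finset V
  tgt : Finset V
  src_ssubset_tgt : src ⊂ tgt
  bound : ℕ∞

/-- The cardinality constraint `(∅, F, N)`. -/
def DegreeConstraint.card {V : Type*} (F : Finset V) (hF : F.Nonempty) (N : ℕ∞) :
    DegreeConstraint V :=
  ⟨∅, F, Finset.empty_ssubset.2 hF, N⟩

/-- The functional dependency `X → Y`, i.e. the degree constraint `(X, Y, 1)`. -/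
def DegreeConstraint.fd {V : Type*} (X Y : Finset V) (hXY : X ⊂ Y) : DegreeConstraint V :=
  ⟨X, Y, hXY, 1⟩

/-- A conjunctive query with degree constraints, with set of variables `V`. It has a finite
multiset of atoms, given by their supports (so that `(V, edges)` is the multi-hypergraph of the
query), and a finite set of degree constraints, each of which lives inside the support of some
atom (the guard of the constraint). -/
structure Query (V : Type*) where
  edges : Multiset (Finset V)
  constraints : Set (DegreeConstraint V)
  finite_constraints : constraints.Finite
  guarded : ∀ c ∈ constraints, ∃ F ∈ edges, c.tgt ⊆ F

/-- Tree decompositions of the hypergraph `(V, edges)`. The nodes of the (finite, nonempty) tree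
are numbered `0, …, size - 1`. -/
structure TreeDecomposition {V : Type*} (edges : Multiset (Finset V)) where
  size : ℕ
  tree : SimpleGraph (Fin size)
  isTree : tree.IsTree
  bag : Fin size → Finset V
  edge_subset : ∀ F ∈ edges, ∃ t, F ⊆ bag t
  subtree : ∀ v, (tree.induce {t | v ∈ bag t}).Connected

/-! ### Classes of set functions -/

/-- `Γ_n`: nonnegative, monotone, submodular set functions vanishing at `∅`. -/
def polymatroids (V : Type*) [DecidableEq V] : Set (Finset V → ℝ) :=
  {h | (∀ S, 0 ≤ h S) ∧ h ∅ = 0 ∧ (∀ X Y, X ⊆ Y → h X ≤ h Y) ∧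
    ∀ X Y, h (X ∪ Y) + h (X ∩ Y) ≤ h X + h Y}

/-- The Shannon entropy, in bits, of a distribution on a finite set. -/
noncomputable def entropy {α : Type*} [Fintype α] (p : PMF α) : ℝ :=
  ∑ a, Real.negMulLog (p a).toReal / Real.log 2

/-- `Γ*_n`: the set functions `S ↦ H(A_S)` of jointly distributed random variables `(A_v)_{v ∈ V}`
with finite domains `D v`. -/
def entropic (V : Type*) [DecidableEq V] : Set (Finset V → ℝ) :=
  {h | ∃ (D : V → Type) (_ : ∀ v, Fintype (D v)) (p : PMF (∀ v, D v)),
    ∀ S : Finset V, h S = entropy (p.map S.restrict)}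

/-- Base-2 logarithm on `ℕ ∪ {∞}`, with `log 0 = -∞` and `log ∞ = ∞`. -/
noncomputable def log2 (N : ℕ∞) : EReal :=
  if N = ⊤ then ⊤ else if N = 0 then ⊥ else ((Real.logb 2 (N.toNat : ℝ) : ℝ) : EReal)

/-- `HDC`: the set functions with `h(Y|X) = h(Y) - h(X) ≤ log N_{Y|X}` for all degree
constraints `(X, Y, N_{Y|X})` of the query. -/
def HDC {V : Type*} (Q : Query V) : Set (Finset V → ℝ) :=
  {h | ∀ c ∈ Q.constraints, ((h c.tgt - h c.src : ℝ) : EReal) ≤ log2 c.bound}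

/-! ### Width parameters -/

/-- `min_{(T,χ)} max_t max_{h ∈ 𝓕} h(χ(t))`, as an extended real number. -/
noncomputable def minimaxWidth {V : Type*} (𝓕 : Set (Finset V → ℝ)) (Q : Query V) : EReal :=
  ⨅ T : TreeDecomposition Q.edges, ⨆ t : Fin T.size, ⨆ h ∈ 𝓕, ((h (T.bag t) : ℝ) : EReal)

/-- `max_{h ∈ 𝓕} min_{(T,χ)} max_t h(χ(t))`, as an extended real number. -/
noncomputable def maximinWidth {V : Type*} (𝓕 : Set (Finset V → ℝ)) (Q : Query V) : EReal :=
  ⨆ h ∈ 𝓕, ⨅ T : TreeDecomposition Q.edges, ⨆ t : Fin T.size, ((h (T.bag t) : ℝ) : EReal)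

section Widths

variable {V : Type*} [DecidableEq V]

noncomputable def daFhtw (Q : Query V) : EReal := minimaxWidth (polymatroids V ∩ HDC Q) Q

noncomputable def daSubw (Q : Query V) : EReal := maximinWidth (polymatroids V ∩ HDC Q) Q

noncomputable def edaFhtw (Q : Query V) : EReal := minimaxWidth (closure (entropic V) ∩ HDC Q) Q

noncomputable def edaSubw (Q : Query V) : EReal := maximinWidth (closure (entropic V) ∩ HDC Q) Q

end Widths

/-- All finite degree bounds of the query are at most `N`. -/
def Query.BoundedBy {V : Type*} (Q : Query V) (N : ℕ) : Prop :=
  ∀ c ∈ Q.constraints, c.bound ≠ ⊤ → c.bound ≤ N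

/-- `b` exceeds `a` by at least `C`, both being finite. -/
def GapAtLeast (C : ℝ) (a b : EReal) : Prop :=
  ∃ x y : ℝ, a = (x : EReal) ∧ b = (y : EReal) ∧ x + C ≤ y

/-! ### Two concrete queries -/

/-- The 4-cycle query `R₀₁(A₀,A₁), R₁₂(A₁,A₂), R₂₃(A₂,A₃), R₃₀(A₃,A₀)` with all four relations of
size at most `N`. -/
def fourCycle (N : ℕ) : Query (Fin 4) where
  edges := {{0, 1}, {1, 2}, {2, 3}, {3, 0}}
  constraints :=
    {.card {0, 1} (by simp) N, .card {1, 2} (by simp) N,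
     .card {2, 3} (by simp) N, .card {3, 0} (by simp) N}
  finite_constraints := by simp
  guarded := by
    rintro c (rfl | rfl | rfl | rfl)
    · exact ⟨{0, 1}, by simp, subset_rfl⟩
    · exact ⟨{1, 2}, by simp, subset_rfl⟩
    · exact ⟨{2, 3}, by simp, subset_rfl⟩
    · exact ⟨{3, 0}, by simp, subset_rfl⟩

/-- The augmented Zhang–Yeung query on the variables `A, B, X, Y, C = 0, 1, 2, 3, 4`: atoms
`K(A,B,X,Y,C), R(X,Y), S(A,X), T(A,Y), U(B,X), V(B,Y), W(C)` with
`|R|, |S|, |T|, |U|, |V| ≤ N³`, `|W| ≤ N²`, the keys `AB, AXY, BXY, AC, XC, YC` in `K`, and one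
more atom on all five variables, of size at most `M`. -/
def zhangYeungPlus (N : ℕ) (M : ℕ∞) : Query (Fin 5) where
  edges := {Finset.univ, {2, 3}, {0, 2}, {0, 3}, {1, 2}, {1, 3}, {4}, Finset.univ}
  constraints :=
    {.card {2, 3} (by simp) ((N ^ 3 : ℕ) : ℕ∞),
     .card {0, 2} (by simp) ((N ^ 3 : ℕ) : ℕ∞),
     .card {0, 3} (by simp) ((N ^ 3 : ℕ) : ℕ∞),
     .card {1, 2} (by simp) ((N ^ 3 : ℕ) : ℕ∞),
     .card {1, 3} (by simp) ((N ^ 3 : ℕ) : ℕ∞),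
     .card {4} (by simp) ((N ^ 2 : ℕ) : ℕ∞),
     .fd {0, 1} Finset.univ (by decide),
     .fd {0, 2, 3} Finset.univ (by decide),
     .fd {1, 2, 3} Finset.univ (by decide),
     .fd {0, 4} Finset.univ (by decide),
     .fd {2, 4} Finset.univ (by decide),
     .fd {3, 4} Finset.univ (by decide),
     .card Finset.univ (by simp) M}
  finite_constraints := by simp
  guarded := fun _ _ => ⟨Finset.univ, by simp, Finset.subset_univ _⟩

end DegreeAware

/-! The four inequalities are formal: a max-min is at most the corresponding min-max, and
almost-entropic functions are polymatroids. The content lies in two examples and a way of amplifying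
them.

On the 4-cycle, every tree decomposition has a bag containing three consecutive vertices
(`TreeDecomposition.exists_three_blocks`). In the minimax the adversary sees the decomposition, so
the two outer vertices of that bag can be made independent and uniform, the others constant; this
costs `2 log N`, the trivial upper bound from two opposite edges. In the maximin the decomposition
is chosen after `h`. Submodularity bounds the sum of two adjacent triples by three edges, so one of
the two diagonal decompositions costs at most `3/2 log N`, attained by `h(S) = |S|/2 · log N`.

In the Zhang–Yeung query an atom contains all variables, so every decomposition has a full bag and
only `h(V)` matters. The Zhang–Yeung inequality, valid on the closure of the entropic functions,
forces `h(V) ≤ 43/11 · log N`, whereas `nonZhangYeungRank`, which violates that inequality by 34 to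
33, gives a polymatroid with `h(V) = 4 log N`. The inequality itself follows from the copy lemma
(`exists_copy`) and a five-variable Shannon inequality (`shannon_five`). Random variables are
treated as partitions of one finite weighted space: finer means smaller, and a joint variable is a
meet.

For unbounded gaps, take `k` copies of every variable with constraints on each copy separately.
Direct sums scale lower bounds by `k`, subadditivity scales upper bounds by `k`, and the degree
bounds do not change. The cycle separates both subw parameters from both fhtw parameters, and the
Zhang–Yeung query separates both entropic parameters from both polymatroid ones; this covers all
four gaps. -/

namespace DegreeAware

/-! ### Entropy of a partition -/

section PartitionEntropy

variable {Ω : Type*} [Fintype Ω]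

open Classical in
/-- The total weight of the class of `ω`. -/
noncomputable def classMass (w : Ω → ℝ) (r : Setoid Ω) (ω : Ω) : ℝ :=
  ∑ ω', if r ω ω' then w ω' else 0

/-- The entropy (in nats) of the partition `r` of a finite weighted set. -/
noncomputable def partitionEntropy (w : Ω → ℝ) (r : Setoid Ω) : ℝ :=
  -∑ ω, w ω * Real.log (classMass w r ω)

lemma classMass_congr (w : Ω → ℝ) (r : Setoid Ω) {a b : Ω} (h : r a b) :
    classMass w r a = classMass w r b := by
  unfold classMass
  refine Finset.sum_congr rfl fun c _ => ?_
  have : r a c ↔ r b c := ⟨fun h' => r.trans (r.symm h) h', fun h' => r.trans h h'⟩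
  by_cases hb : r b c
  · rw [if_pos hb, if_pos (this.2 hb)]
  · rw [if_neg hb, if_neg (mt this.1 hb)]

lemma classMass_nonneg {w : Ω → ℝ} (hw : ∀ ω, 0 ≤ w ω) (r : Setoid Ω) (ω : Ω) :
    0 ≤ classMass w r ω :=
  Finset.sum_nonneg fun c _ => by split_ifs <;> simp [hw]

lemma le_classMass {w : Ω → ℝ} (hw : ∀ ω, 0 ≤ w ω) (r : Setoid Ω) (ω : Ω) :
    w ω ≤ classMass w r ω := by
  classical
  have := Finset.single_le_sum (f := fun c => if r ω c then w c else 0)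
    (fun c _ => by split_ifs <;> simp [hw]) (Finset.mem_univ ω)
  simpa [classMass, r.refl ω] using this

lemma classMass_mono {w : Ω → ℝ} (hw : ∀ ω, 0 ≤ w ω) {r s : Setoid Ω} (h : r ≤ s) (ω : Ω) :
    classMass w r ω ≤ classMass w s ω := by
  refine Finset.sum_le_sum fun c _ => ?_
  by_cases hr : r ω c
  · simp [hr, h hr]
  · simp only [hr, if_false]
    split_ifs <;> simp [hw]

lemma partitionEntropy_anti {w : Ω → ℝ} (hw : ∀ ω, 0 ≤ w ω) {r s : Setoid Ω} (h : r ≤ s) :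
    partitionEntropy w s ≤ partitionEntropy w r := by
  refine neg_le_neg (Finset.sum_le_sum fun ω _ => ?_)
  rcases (hw ω).eq_or_lt with h0 | h0
  · simp [← h0]
  · exact mul_le_mul_of_nonneg_left (Real.log_le_log (h0.trans_le (le_classMass hw r ω))
      (classMass_mono hw h ω)) h0.le

/-- Nonnegativity of conditional mutual information, `I(r; s | t) ≥ 0`, from `log x ≤ x - 1`. The
common coarsening `t` need not be the join, so it can be taken to be agreement on an intersection of
coordinate sets. -/
lemma partitionEntropy_inf_add_le {w : Ω → ℝ} (hw : ∀ ω, 0 ≤ w ω) {r s t : Setoid Ω}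
    (hr : r ≤ t) (hs : s ≤ t) :
    partitionEntropy w (r ⊓ s) + partitionEntropy w t ≤
      partitionEntropy w r + partitionEntropy w s := by
  classical
  set R := classMass w r
  set S := classMass w s
  set T := classMass w t
  set U := classMass w (r ⊓ s)
  have hRn := classMass_nonneg hw r
  have hSn := classMass_nonneg hw s
  have hTn := classMass_nonneg hw t
  have hUn := classMass_nonneg hw (r ⊓ s)
  -- The points that are `r`-related to `a` and `s`-related to `b` form one class of `r ⊓ s`, or
  -- none. On it `U` and `T` are constant and the weights sum to `U`, which cancels.
  have inner (a b : Ω) : ∑ ω, (if r ω a ∧ s ω b then w ω / (U ω * T ω) else 0) ≤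
      if t a b then 1 / T a else 0 := by
    by_cases hex : ∃ c, r c a ∧ s c b
    · obtain ⟨c, hca, hcb⟩ := hex
      have htab : t a b := t.trans (t.symm (hr hca)) (hs hcb)
      have hstep (ω : Ω) : (if r ω a ∧ s ω b then w ω / (U ω * T ω) else 0) =
          (if (r ⊓ s) c ω then w ω else 0) / (U c * T a) := by
        have hiff : (r ω a ∧ s ω b) ↔ (r ⊓ s) c ω := by
          change _ ↔ r c ω ∧ s c ω
          exact ⟨fun h => ⟨r.trans hca (r.symm h.1), s.trans hcb (s.symm h.2)⟩,
            fun h => ⟨r.trans (r.symm h.1) hca, s.trans (s.symm h.2) hcb⟩⟩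
        by_cases h : (r ⊓ s) c ω
        · have hU : U c = U ω := classMass_congr w (r ⊓ s) h
          have hT : T ω = T a := classMass_congr w t (hr (hiff.2 h).1)
          rw [if_pos (hiff.2 h), if_pos h, hU, hT]
        · rw [if_neg (mt hiff.1 h), if_neg h, zero_div]
      rw [Finset.sum_congr rfl fun ω _ => hstep ω, ← Finset.sum_div, if_pos htab]
      change U c / (U c * T a) ≤ 1 / T a
      rcases (hUn c).eq_or_lt with h0 | h0
      · change 0 = U c at h0
        rw [← h0]; simpa using hTn a
      · rw [div_mul_eq_div_div, div_self h0.ne']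
    · push Not at hex
      rw [Finset.sum_eq_zero fun ω _ => if_neg fun h => hex ω h.1 h.2]
      split_ifs
      · exact one_div_nonneg.2 (hTn a)
      · exact le_rfl
  -- The ratio `R S / (U T)` has weighted sum at most the total mass: expand `R` and `S` as sums
  -- over `a` and `b`, and sum over `ω` first.
  have key : ∑ ω, w ω * (R ω * S ω / (U ω * T ω)) ≤ ∑ ω, w ω := by
    calc ∑ ω, w ω * (R ω * S ω / (U ω * T ω))
        = ∑ ω, ∑ a, ∑ b, w a * w b * (if r ω a ∧ s ω b then w ω / (U ω * T ω) else 0) := by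
          refine Finset.sum_congr rfl fun ω _ => ?_
          have : R ω * S ω = ∑ a, ∑ b, (if r ω a then w a else 0) * (if s ω b then w b else 0) := by
            rw [← Finset.sum_mul_sum]; rfl
          rw [mul_div_assoc', mul_comm (w ω), mul_div_assoc, this, Finset.sum_mul]
          refine Finset.sum_congr rfl fun a _ => ?_
          rw [Finset.sum_mul]
          refine Finset.sum_congr rfl fun b _ => ?_
          by_cases h1 : r ω a <;> by_cases h2 : s ω b <;> simp [h1, h2]
      _ = ∑ a, ∑ b, w a * w b * ∑ ω, (if r ω a ∧ s ω b then w ω / (U ω * T ω) else 0) := by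
          rw [Finset.sum_comm]
          refine Finset.sum_congr rfl fun a _ => ?_
          rw [Finset.sum_comm]
          exact Finset.sum_congr rfl fun b _ => (Finset.mul_sum _ _ _).symm
      _ ≤ ∑ a, ∑ b, w a * w b * (if t a b then 1 / T a else 0) :=
          Finset.sum_le_sum fun a _ => Finset.sum_le_sum fun b _ =>
            mul_le_mul_of_nonneg_left (inner a b) (mul_nonneg (hw a) (hw b))
      _ = ∑ a, w a * (T a / T a) := by
          refine Finset.sum_congr rfl fun a _ => ?_
          have : T a = ∑ b, if t a b then w b else 0 := rfl
          rw [div_eq_mul_one_div (T a) (T a)]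
          nth_rw 2 [this]
          rw [Finset.sum_mul, Finset.mul_sum]
          refine Finset.sum_congr rfl fun b _ => ?_
          split_ifs <;> ring
      _ ≤ ∑ a, w a := Finset.sum_le_sum fun a _ =>
          mul_le_of_le_one_right (hw a) (div_self_le_one _)
  have pointwise (ω : Ω) : w ω - w ω * (R ω * S ω / (U ω * T ω)) ≤
      w ω * Real.log (U ω) + w ω * Real.log (T ω) - w ω * Real.log (R ω) -
        w ω * Real.log (S ω) := by
    rcases (hw ω).eq_or_lt with h0 | h0
    · simp [← h0]
    · have hR : 0 < R ω := h0.trans_le (le_classMass hw r ω)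
      have hS : 0 < S ω := h0.trans_le (le_classMass hw s ω)
      have hT : 0 < T ω := h0.trans_le (le_classMass hw t ω)
      have hU : 0 < U ω := h0.trans_le (le_classMass hw (r ⊓ s) ω)
      have := Real.log_le_sub_one_of_pos (div_pos (mul_pos hR hS) (mul_pos hU hT))
      rw [Real.log_div (by positivity) (by positivity), Real.log_mul hR.ne' hS.ne',
        Real.log_mul hU.ne' hT.ne'] at this
      nlinarith
  have total := Finset.sum_le_sum fun ω (_ : ω ∈ Finset.univ) => pointwise ω
  simp only [Finset.sum_sub_distrib, Finset.sum_add_distrib] at total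
  unfold partitionEntropy
  linarith

lemma partitionEntropy_submodular {w : Ω → ℝ} (hw : ∀ ω, 0 ≤ w ω) {r s t u : Setoid Ω}
    (hu : r ⊓ s ≤ u) (hr : r ≤ t) (hs : s ≤ t) :
    partitionEntropy w u + partitionEntropy w t ≤ partitionEntropy w r + partitionEntropy w s :=
  (add_le_add_left (partitionEntropy_anti hw hu) _).trans (partitionEntropy_inf_add_le hw hr hs)

open Classical in
lemma sum_mul_comp {Ω' : Type*} [Fintype Ω'] {w : Ω → ℝ} {q : Ω' → ℝ} {π : Ω' → Ω}
    (hπ : ∀ ω, ∑ p, (if π p = ω then q p else 0) = w ω) (F : Ω → ℝ) :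
    ∑ p, q p * F (π p) = ∑ ω, w ω * F ω := by
  simp_rw [← hπ, Finset.sum_mul]
  rw [Finset.sum_comm]
  refine Finset.sum_congr rfl fun p _ => ?_
  simp [ite_mul]

open Classical in
-- The classes of the pulled-back partition are preimages of classes, and `hπ` says that `q` pushes
-- forward to `w`.
lemma partitionEntropy_comap {Ω' : Type*} [Fintype Ω'] {w : Ω → ℝ} {q : Ω' → ℝ} {π : Ω' → Ω}
    (hπ : ∀ ω, ∑ p, (if π p = ω then q p else 0) = w ω) (r : Setoid Ω) :
    partitionEntropy q (r.comap π) = partitionEntropy w r := by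
  have hmass (p : Ω') : classMass q (r.comap π) p = classMass w r (π p) := by
    have := sum_mul_comp hπ fun ω => if r (π p) ω then 1 else 0
    simpa [classMass, Setoid.comap_rel] using this
  unfold partitionEntropy
  rw [← sum_mul_comp hπ fun ω => Real.log (classMass w r ω)]
  simp only [hmass]

end PartitionEntropy

/-! ### The Zhang–Yeung inequality -/

section ZhangYeung

variable {Ω : Type*} [Fintype Ω]

lemma classMass_bot (w : Ω → ℝ) (ω : Ω) : classMass w ⊥ ω = w ω := by
  classical
  simp [classMass]

open Classical in
/-- The copy lemma: two copies of the sample space, conditionally independent given the class of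
`z`. -/
lemma exists_copy {w : Ω → ℝ} (hw : ∀ ω, 0 ≤ w ω) (z : Setoid Ω) :
    ∃ q : {p : Ω × Ω // z p.1 p.2} → ℝ, (∀ p, 0 ≤ q p) ∧
      (∀ ω, ∑ p, (if p.1.1 = ω then q p else 0) = w ω) ∧
      (∀ ω, ∑ p, (if p.1.2 = ω then q p else 0) = w ω) ∧
      partitionEntropy q ⊥ + partitionEntropy w z =
        partitionEntropy w ⊥ + partitionEntropy w ⊥ := by
  have hsub (f : Ω × Ω → ℝ) : ∑ p : {p : Ω × Ω // z p.1 p.2}, f p =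
      ∑ u, ∑ v, if z u v then f (u, v) else 0 := by
    rw [← Finset.sum_subtype (Finset.univ.filter fun p : Ω × Ω => z p.1 p.2) (by simp) f,
      Finset.sum_filter, Fintype.sum_prod_type]
  have hcancel (ω : Ω) : w ω * (classMass w z ω / classMass w z ω) = w ω := by
    rcases (hw ω).eq_or_lt with h0 | h0
    · simp [← h0]
    · rw [div_self (h0.trans_le (le_classMass hw z ω)).ne', mul_one]
  -- Within each class of `z` the two coordinates are drawn independently. Both marginals are `w`,
  -- so taking logarithms of this product formula gives the entropy identity.
  let q : {p : Ω × Ω // z p.1 p.2} → ℝ := fun p => w p.1.1 * w p.1.2 / classMass w z p.1.1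
  have hq (p) : 0 ≤ q p := div_nonneg (mul_nonneg (hw _) (hw _)) (classMass_nonneg hw _ _)
  have h1 (ω : Ω) : ∑ p : {p : Ω × Ω // z p.1 p.2}, (if p.1.1 = ω then q p else 0) = w ω := by
    refine (hsub fun p => if p.1 = ω then w p.1 * w p.2 / classMass w z p.1 else 0).trans ?_
    rw [Finset.sum_eq_single ω]
    · rw [← hcancel ω]
      conv_rhs => enter [2, 1]; rw [classMass]
      rw [Finset.sum_div, Finset.mul_sum]
      refine Finset.sum_congr rfl fun v _ => ?_
      by_cases h : z ω v
      · simp [h, mul_div_assoc]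
      · simp [h]
    · intro u _ hu
      simp [hu]
    · simp
  have h2 (ω : Ω) : ∑ p : {p : Ω × Ω // z p.1 p.2}, (if p.1.2 = ω then q p else 0) = w ω := by
    refine (hsub fun p => if p.2 = ω then w p.1 * w p.2 / classMass w z p.1 else 0).trans ?_
    rw [Finset.sum_comm, Finset.sum_eq_single ω]
    · rw [← hcancel ω]
      conv_rhs => enter [2, 1]; rw [classMass]
      rw [Finset.sum_div, Finset.mul_sum]
      refine Finset.sum_congr rfl fun v _ => ?_
      by_cases h : z v ω
      · simp [h, z.symm h, mul_div_assoc, mul_comm, classMass_congr w z h]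
      · simp [h, show ¬ z ω v from fun h' => h (z.symm h')]
    · intro u _ hu
      simp [hu]
    · simp
  refine ⟨q, hq, h1, h2, ?_⟩
  have hlog (p) : q p * Real.log (q p) = q p * Real.log (w p.1.1) + q p * Real.log (w p.1.2) -
      q p * Real.log (classMass w z p.1.1) := by
    rcases (hw p.1.1).eq_or_lt with h0 | h0
    · simp [q, ← h0]
    rcases (hw p.1.2).eq_or_lt with h0' | h0'
    · simp [q, ← h0']
    have := h0.trans_le (le_classMass hw z p.1.1)
    rw [← mul_add, ← mul_sub, ← Real.log_mul h0.ne' h0'.ne', ← Real.log_div (by positivity) this.ne']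
  simp only [partitionEntropy, classMass_bot, hlog, Finset.sum_sub_distrib, Finset.sum_add_distrib]
  rw [sum_mul_comp h1 fun ω => Real.log (w ω), sum_mul_comp h2 fun ω => Real.log (w ω),
    sum_mul_comp h1 fun ω => Real.log (classMass w z ω)]
  ring

/-- A Shannon inequality in five variables, for submodular functions on a lattice. -/
lemma shannon_five {L : Type*} [Lattice L] {H : L → ℝ}
    (sub : ∀ r s t u, r ⊓ s ≤ u → r ≤ t → s ≤ t → H u + H t ≤ H r + H s) (A B X Y E : L) :
    H X + H Y - H (X ⊓ Y) ≤
      (H (A ⊓ X) + H (A ⊓ Y) - H (A ⊓ X ⊓ Y) - H A) +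
      (H (B ⊓ X) + H (B ⊓ Y) - H (B ⊓ X ⊓ Y) - H B) + (H A + H B - H (A ⊓ B)) +
      (H (X ⊓ E) + H (Y ⊓ E) - H (X ⊓ Y ⊓ E) - H E) +
      (H (Y ⊓ E) + H (X ⊓ Y) - H (X ⊓ Y ⊓ E) - H Y) +
      (H (X ⊓ E) + H (X ⊓ Y) - H (X ⊓ Y ⊓ E) - H X) +
      3 * (H (X ⊓ Y ⊓ E) + H (A ⊓ B ⊓ X ⊓ Y) - H (A ⊓ B ⊓ X ⊓ Y ⊓ E) - H (X ⊓ Y)) := by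
  -- The gap between the two sides is a nonnegative combination of these eleven conditional mutual
  -- informations.
  linarith [
    sub (B ⊓ X ⊓ E) (B ⊓ Y ⊓ E) (B ⊓ E) (B ⊓ X ⊓ Y ⊓ E) (by order) (by order) (by order),
    sub (A ⊓ B ⊓ X ⊓ Y) (A ⊓ X ⊓ Y ⊓ E) (A ⊓ X ⊓ Y) (A ⊓ B ⊓ X ⊓ Y ⊓ E)
      (by order) (by order) (by order),
    sub (B ⊓ X) (X ⊓ E) X (B ⊓ X ⊓ E) (by order) (by order) (by order),
    sub (A ⊓ X) (X ⊓ E) X (A ⊓ X ⊓ E) (by order) (by order) (by order),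
    sub (A ⊓ B ⊓ X ⊓ Y) (A ⊓ B ⊓ Y ⊓ E) (A ⊓ B ⊓ Y) (A ⊓ B ⊓ X ⊓ Y ⊓ E)
      (by order) (by order) (by order),
    sub (A ⊓ Y) (Y ⊓ E) Y (A ⊓ Y ⊓ E) (by order) (by order) (by order),
    sub (A ⊓ X ⊓ E) (A ⊓ Y ⊓ E) (A ⊓ E) (A ⊓ X ⊓ Y ⊓ E) (by order) (by order) (by order),
    sub (A ⊓ B ⊓ Y) (A ⊓ B ⊓ E) (A ⊓ B) (A ⊓ B ⊓ Y ⊓ E) (by order) (by order) (by order),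
    sub (A ⊓ E) (B ⊓ E) E (A ⊓ B ⊓ E) (by order) (by order) (by order),
    sub (A ⊓ B ⊓ X ⊓ Y) (B ⊓ X ⊓ Y ⊓ E) (B ⊓ X ⊓ Y) (A ⊓ B ⊓ X ⊓ Y ⊓ E)
      (by order) (by order) (by order),
    sub (B ⊓ Y) (Y ⊓ E) Y (B ⊓ Y ⊓ E) (by order) (by order) (by order)
  ]

/-- Data processing: if `D₁` and `D₂` are independent given `Z`, then so are their images. -/
lemma condIndep_of_le {L : Type*} [Lattice L] [OrderBot L] {H : L → ℝ}
    (sub : ∀ r s t u, r ⊓ s ≤ u → r ≤ t → s ≤ t → H u + H t ≤ H r + H s) {D₁ D₂ F G Z FG : L}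
    (hD : D₁ ⊓ D₂ ≤ ⊥) (hF : D₁ ≤ F) (hG : D₂ ≤ G)
    (hFG : F ⊓ G = FG) (h : H D₁ + H D₂ ≤ H ⊥ + H Z) : H F + H G ≤ H FG + H Z := by
  subst hFG
  linarith [sub D₁ (D₂ ⊓ F) F ⊥ (by order) (by order) (by order),
    sub D₂ (F ⊓ G) G (D₂ ⊓ F) (by order) (by order) (by order)]

/-- Rearranged, this is `I(x;y) ≤ 2 I(x;y|a) + I(x;y|b) + I(a;b) + I(a;x|y) + I(a;y|x)`. Apply
`shannon_five` with `E` a copy of `a` that is independent of the original variables given `(x, y)`: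
its last term vanishes, and `E` has the same joint entropies with `x, y` as `a`. -/
theorem partitionEntropy_zhangYeung {w : Ω → ℝ} (hw : ∀ ω, 0 ≤ w ω) (a b x y : Setoid Ω) :
    partitionEntropy w (a ⊓ b) + 4 * partitionEntropy w (a ⊓ x ⊓ y) +
        partitionEntropy w (b ⊓ x ⊓ y) + partitionEntropy w a + 2 * partitionEntropy w x +
        2 * partitionEntropy w y ≤
      3 * partitionEntropy w (x ⊓ y) + 3 * partitionEntropy w (a ⊓ x) +
        3 * partitionEntropy w (a ⊓ y) + partitionEntropy w (b ⊓ x) +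
        partitionEntropy w (b ⊓ y) := by
  classical
  obtain ⟨q, hq, h1, h2, hbot⟩ := exists_copy hw (x ⊓ y)
  have e1 (r : Setoid Ω) := partitionEntropy_comap h1 r
  have e2 (r : Setoid Ω) := partitionEntropy_comap h2 r
  set D₁ : Setoid {p : Ω × Ω // (x ⊓ y) p.1 p.2} := (⊥ : Setoid Ω).comap fun p => p.1.1
  set D₂ : Setoid {p : Ω × Ω // (x ⊓ y) p.1 p.2} := (⊥ : Setoid Ω).comap fun p => p.1.2
  set A : Setoid {p : Ω × Ω // (x ⊓ y) p.1 p.2} := a.comap fun p => p.1.1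
  set B : Setoid {p : Ω × Ω // (x ⊓ y) p.1 p.2} := b.comap fun p => p.1.1
  set X : Setoid {p : Ω × Ω // (x ⊓ y) p.1 p.2} := x.comap fun p => p.1.1
  set Y : Setoid {p : Ω × Ω // (x ⊓ y) p.1 p.2} := y.comap fun p => p.1.1
  set E : Setoid {p : Ω × Ω // (x ⊓ y) p.1 p.2} := a.comap fun p => p.1.2
  -- The two coordinates of a point agree modulo `x ⊓ y`, so `x` and `y` may be read off either
  -- copy.
  have hX' : X = x.comap fun p => p.1.2 := by
    ext p p'
    exact ⟨fun h => x.trans (x.symm p.2.1) (x.trans h p'.2.1),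
      fun h => x.trans p.2.1 (x.trans h (x.symm p'.2.1))⟩
  have hY' : Y = y.comap fun p => p.1.2 := by
    ext p p'
    exact ⟨fun h => y.trans (y.symm p.2.2) (y.trans h p'.2.2),
      fun h => y.trans p.2.2 (y.trans h (y.symm p'.2.2))⟩
  have hD : D₁ ⊓ D₂ ≤ ⊥ := fun p p' h => Subtype.ext (Prod.ext h.1 h.2)
  have D₁le (r : Setoid Ω) : D₁ ≤ r.comap fun p => p.1.1 := fun p p' h => by
    change p.1.1 = p'.1.1 at h
    change r p.1.1 p'.1.1
    rw [h]
  have D₂le (r : Setoid Ω) : D₂ ≤ r.comap fun p => p.1.2 := fun p p' h => by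
    change p.1.2 = p'.1.2 at h
    change r p.1.2 p'.1.2
    rw [h]
  have D₁A : D₁ ≤ A := D₁le a
  have D₁B : D₁ ≤ B := D₁le b
  have D₁X : D₁ ≤ X := D₁le x
  have D₁Y : D₁ ≤ Y := D₁le y
  have D₂E : D₂ ≤ E := D₂le a
  have D₂X : D₂ ≤ X := hX' ▸ D₂le x
  have D₂Y : D₂ ≤ Y := hY' ▸ D₂le y
  have fD₁ : partitionEntropy q D₁ = partitionEntropy w ⊥ := e1 ⊥
  have fD₂ : partitionEntropy q D₂ = partitionEntropy w ⊥ := e2 ⊥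
  have fA : partitionEntropy q A = partitionEntropy w a := e1 a
  have fX : partitionEntropy q X = partitionEntropy w x := e1 x
  have fY : partitionEntropy q Y = partitionEntropy w y := e1 y
  have fAB : partitionEntropy q (A ⊓ B) = partitionEntropy w (a ⊓ b) := e1 (a ⊓ b)
  have fAX : partitionEntropy q (A ⊓ X) = partitionEntropy w (a ⊓ x) := e1 (a ⊓ x)
  have fAY : partitionEntropy q (A ⊓ Y) = partitionEntropy w (a ⊓ y) := e1 (a ⊓ y)
  have fBX : partitionEntropy q (B ⊓ X) = partitionEntropy w (b ⊓ x) := e1 (b ⊓ x)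
  have fBY : partitionEntropy q (B ⊓ Y) = partitionEntropy w (b ⊓ y) := e1 (b ⊓ y)
  have fXY : partitionEntropy q (X ⊓ Y) = partitionEntropy w (x ⊓ y) := e1 (x ⊓ y)
  have fAXY : partitionEntropy q (A ⊓ X ⊓ Y) = partitionEntropy w (a ⊓ x ⊓ y) := e1 (a ⊓ x ⊓ y)
  have fBXY : partitionEntropy q (B ⊓ X ⊓ Y) = partitionEntropy w (b ⊓ x ⊓ y) := e1 (b ⊓ x ⊓ y)
  have fE : partitionEntropy q E = partitionEntropy w a := e2 a
  have fEX : partitionEntropy q (X ⊓ E) = partitionEntropy w (a ⊓ x) := by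
    rw [inf_comm a x, hX']; exact e2 (x ⊓ a)
  have fEY : partitionEntropy q (Y ⊓ E) = partitionEntropy w (a ⊓ y) := by
    rw [inf_comm a y, hY']; exact e2 (y ⊓ a)
  have fEXY : partitionEntropy q (X ⊓ Y ⊓ E) = partitionEntropy w (a ⊓ x ⊓ y) := by
    rw [inf_assoc a x y, inf_comm a, hX', hY']; exact e2 (x ⊓ y ⊓ a)
  have sub (r s t u : Setoid {p : Ω × Ω // (x ⊓ y) p.1 p.2}) (hu : r ⊓ s ≤ u) (hr : r ≤ t)
      (hs : s ≤ t) := partitionEntropy_submodular hq hu hr hs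
  clear_value D₁ D₂ A B X Y E
  have indep := condIndep_of_le (F := A ⊓ B ⊓ X ⊓ Y) (G := X ⊓ Y ⊓ E) (Z := X ⊓ Y)
    (FG := A ⊓ B ⊓ X ⊓ Y ⊓ E) sub hD
    (le_inf (le_inf (le_inf D₁A D₁B) D₁X) D₁Y) (le_inf (le_inf D₂X D₂Y) D₂E)
    (by apply le_antisymm <;> order) (by linarith)
  have := shannon_five sub A B X Y E
  linarith

end ZhangYeung

/-! ### Entropic functions -/

lemma sum_toReal_eq_one {Ω : Type*} [Fintype Ω] (p : PMF Ω) : ∑ ω, (p ω).toReal = 1 := by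
  rw [← ENNReal.toReal_sum fun ω _ => p.apply_ne_top ω, ← tsum_fintype (L := .unconditional Ω),
    p.tsum_coe, ENNReal.toReal_one]

lemma entropy_map {Ω α : Type*} [Fintype Ω] [Fintype α] (p : PMF Ω) (f : Ω → α) :
    entropy (p.map f) =
      partitionEntropy (fun ω => (p ω).toReal) (Setoid.ker f) / Real.log 2 := by
  classical
  have hmap (a : α) : (p.map f a).toReal = ∑ ω, if a = f ω then (p ω).toReal else 0 := by
    rw [PMF.map_apply, tsum_fintype, ENNReal.toReal_sum]
    · refine Finset.sum_congr rfl fun ω _ => ?_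
      by_cases h : a = f ω <;> simp [h]
    · intro ω _
      split_ifs
      · exact p.apply_ne_top ω
      · simp
  have hmass (ω : Ω) : classMass (fun ω => (p ω).toReal) (Setoid.ker f) ω =
      (p.map f (f ω)).toReal := by
    rw [hmap, classMass]
    refine Finset.sum_congr rfl fun ω' _ => ?_
    simp only [Setoid.ker_def]
  rw [entropy, ← Finset.sum_div, partitionEntropy]
  congr 1
  simp only [hmass, Real.negMulLog, neg_mul, Finset.sum_neg_distrib]
  congr 1
  have : ∀ a, (p.map f a).toReal * Real.log (p.map f a).toReal =
      ∑ ω, if a = f ω then (p ω).toReal * Real.log (p.map f (f ω)).toReal else 0 := by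
    intro a
    nth_rw 1 [hmap a]
    rw [Finset.sum_mul]
    refine Finset.sum_congr rfl fun ω _ => ?_
    by_cases h : a = f ω
    · simp [h]
    · simp [h]
  simp_rw [this]
  rw [Finset.sum_comm]
  simp

section Agreement

variable {V : Type*} {D : V → Type*}

/-- Agreement of assignments on the coordinates in `S`. -/
def agreeOn (D : V → Type*) (S : Finset V) : Setoid (∀ v, D v) :=
  Setoid.ker S.restrict

lemma agreeOn_iff {S : Finset V} {a b : ∀ v, D v} :
    agreeOn D S a b ↔ ∀ v ∈ S, a v = b v := by
  change S.restrict a = S.restrict b ↔ _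
  simp [funext_iff]

lemma agreeOn_anti {S T : Finset V} (h : S ⊆ T) : agreeOn D T ≤ agreeOn D S :=
  fun _ _ hab => agreeOn_iff.2 fun v hv => agreeOn_iff.1 hab v (h hv)

/-- Unions of coordinate sets become meets, which transfers the lattice inequalities to set
functions. -/
lemma agreeOn_union [DecidableEq V] (S T : Finset V) :
    agreeOn D (S ∪ T) = agreeOn D S ⊓ agreeOn D T := by
  ext a b
  change agreeOn D (S ∪ T) a b ↔ agreeOn D S a b ∧ agreeOn D T a b
  simp only [agreeOn_iff, Finset.mem_union, or_imp, forall_and]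

end Agreement

variable {V : Type*} [DecidableEq V]

/-- The set functions satisfying the Zhang–Yeung inequality. -/
def zhangYeung (V : Type*) [DecidableEq V] : Set (Finset V → ℝ) :=
  {h | ∀ A B X Y, h (A ∪ B) + 4 * h (A ∪ X ∪ Y) + h (B ∪ X ∪ Y) + h A + 2 * h X + 2 * h Y ≤
    3 * h (X ∪ Y) + 3 * h (A ∪ X) + 3 * h (A ∪ Y) + h (B ∪ X) + h (B ∪ Y)}

lemma isClosed_polymatroids : IsClosed (polymatroids V) := by
  unfold polymatroids
  simp only [Set.ofPred_and, Set.ofPred_forall]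
  refine .inter ?_ (.inter ?_ (.inter ?_ ?_))
  · exact isClosed_iInter fun S => isClosed_le continuous_const (continuous_apply S)
  · exact isClosed_eq (continuous_apply _) continuous_const
  · exact isClosed_iInter fun X => isClosed_iInter fun Y => isClosed_iInter fun _ =>
      isClosed_le (continuous_apply X) (continuous_apply Y)
  · exact isClosed_iInter fun X => isClosed_iInter fun Y => isClosed_le (by fun_prop) (by fun_prop)

lemma isClosed_zhangYeung : IsClosed (zhangYeung V) := by
  unfold zhangYeung
  simp only [Set.ofPred_forall]
  exact isClosed_iInter fun A => isClosed_iInter fun B => isClosed_iInter fun X =>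
    isClosed_iInter fun Y => isClosed_le (by fun_prop) (by fun_prop)

lemma entropic_subset [Fintype V] : entropic V ⊆ polymatroids V ∩ zhangYeung V := by
  rintro h ⟨D, _, p, hp⟩
  have hw (ω : ∀ v, D v) : 0 ≤ (p ω).toReal := ENNReal.toReal_nonneg
  have hlog : 0 < Real.log 2 := Real.log_pos one_lt_two
  replace hp (S : Finset V) :
      h S = partitionEntropy (fun ω => (p ω).toReal) (agreeOn D S) / Real.log 2 := by
    rw [hp, entropy_map]; rfl
  have h0 : h ∅ = 0 := by
    have (ω : ∀ v, D v) : classMass (fun ω => (p ω).toReal) (agreeOn D ∅) ω = 1 := by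
      simp [classMass, agreeOn_iff, sum_toReal_eq_one]
    simp [hp, partitionEntropy, this]
  have hmono (X Y : Finset V) (hXY : X ⊆ Y) : h X ≤ h Y := by
    rw [hp, hp]
    exact div_le_div_of_nonneg_right (partitionEntropy_anti hw (agreeOn_anti hXY)) hlog.le
  refine ⟨⟨fun S => h0 ▸ hmono ∅ S (Finset.empty_subset S), h0, hmono, fun X Y => ?_⟩,
    fun A B X Y => ?_⟩
  · simp only [hp, ← add_div]
    exact div_le_div_of_nonneg_right (partitionEntropy_submodular hw (agreeOn_union X Y).ge
      (agreeOn_anti Finset.inter_subset_left) (agreeOn_anti Finset.inter_subset_right)) hlog.le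
  · have := div_le_div_of_nonneg_right (partitionEntropy_zhangYeung hw (agreeOn D A) (agreeOn D B)
      (agreeOn D X) (agreeOn D Y)) hlog.le
    simp only [add_div, mul_div_assoc] at this
    simpa only [hp, agreeOn_union] using this

/-- Non-strict linear inequalities survive limits. This is the only upper control on the closure
that is needed. -/
lemma closure_entropic_subset [Fintype V] :
    closure (entropic V) ⊆ polymatroids V ∩ zhangYeung V :=
  closure_minimal entropic_subset (isClosed_polymatroids.inter isClosed_zhangYeung)

/-- Independent uniform variables are entropic. -/
lemma sum_logb_mem_entropic [Fintype V] (d : V → ℕ) (hd : ∀ v, 0 < d v) :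
    (fun S : Finset V => ∑ v ∈ S, Real.logb 2 (d v)) ∈ entropic V := by
  have : ∀ v, NeZero (d v) := fun v => ⟨(hd v).ne'⟩
  have hd' (S : Finset V) : (∏ v ∈ S, (d v : ℝ)) ≠ 0 :=
    Finset.prod_ne_zero_iff.2 fun v _ => by exact_mod_cast (hd v).ne'
  refine ⟨fun v => Fin (d v), fun v => inferInstance, PMF.uniformOfFintype _, fun S => ?_⟩
  have hcard : (Fintype.card (∀ v, Fin (d v)) : ℝ) = ∏ v, (d v : ℝ) := by
    simp [Fintype.card_pi]
  have hclass (ω : ∀ v, Fin (d v)) : classMass (fun _ => (∏ v, (d v : ℝ))⁻¹)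
      (agreeOn (fun v => Fin (d v)) S) ω = (∏ v ∈ S, (d v : ℝ))⁻¹ := by
    classical
    -- Each class is a box: fixed on `S`, free off `S`.
    have hset : (Finset.univ.filter fun ω' => agreeOn (fun v => Fin (d v)) S ω ω') =
        Fintype.piFinset fun v => if v ∈ S then {ω v} else Finset.univ := by
      ext ω'
      simp only [Finset.mem_filter, Finset.mem_univ, true_and, agreeOn_iff, Fintype.mem_piFinset]
      refine forall_congr' fun v => ?_
      by_cases h : v ∈ S <;> simp [h, eq_comm]
    have hc : ((Fintype.piFinset fun v => if v ∈ S then {ω v} else Finset.univ).card : ℝ) =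
        ∏ v ∈ Sᶜ, (d v : ℝ) := by
      rw [Fintype.card_piFinset, Nat.cast_prod, ← Finset.prod_mul_prod_compl S,
        Finset.prod_eq_one fun v hv => by simp [hv], one_mul]
      exact Finset.prod_congr rfl fun v hv => by simp [Finset.mem_compl.1 hv]
    rw [classMass, ← Finset.sum_filter, hset, Finset.sum_const, nsmul_eq_mul, hc,
      ← Finset.prod_mul_prod_compl S]
    have := hd' S
    have := hd' Sᶜ
    field_simp
  rw [entropy_map]
  change _ = partitionEntropy _ (agreeOn (fun v => Fin (d v)) S) / _
  have hw (ω : ∀ v, Fin (d v)) :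
      (PMF.uniformOfFintype (∀ v, Fin (d v)) ω).toReal = (∏ v, (d v : ℝ))⁻¹ := by
    rw [PMF.uniformOfFintype_apply, ENNReal.toReal_inv, ENNReal.toReal_natCast, hcard]
  simp only [hw, partitionEntropy, hclass, Finset.sum_const, nsmul_eq_mul, Finset.card_univ, hcard]
  rw [← mul_assoc, mul_inv_cancel₀ (hd' Finset.univ), one_mul, Real.log_inv, neg_neg,
    Real.log_prod fun v _ => by exact_mod_cast (hd v).ne', Finset.sum_div]
  rfl

/-! ### Tree decompositions -/

section Trees

variable {W : Type*} {G : SimpleGraph W}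

/-- Any two vertices of `S` are joined by a walk inside `S`. -/
def WalkConnected (G : SimpleGraph W) (S : Set W) : Prop :=
  ∀ a ∈ S, ∀ b ∈ S, ∃ p : G.Walk a b, ∀ x ∈ p.support, x ∈ S

lemma walkConnected_of_preconnected {S : Set W} (h : (G.induce S).Preconnected) :
    WalkConnected G S := by
  intro a ha b hb
  obtain ⟨p⟩ := h ⟨a, ha⟩ ⟨b, hb⟩
  refine ⟨p.map (SimpleGraph.Embedding.induce S).toHom, fun x hx => ?_⟩
  obtain ⟨y, -, rfl⟩ := List.mem_map.1 <|
    (SimpleGraph.Walk.support_map (SimpleGraph.Embedding.induce S).toHom p) ▸ hx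
  exact y.2

lemma WalkConnected.exists_isPath {S : Set W} (h : WalkConnected G S) {a b : W}
    (ha : a ∈ S) (hb : b ∈ S) : ∃ p : G.Walk a b, p.IsPath ∧ ∀ x ∈ p.support, x ∈ S := by
  classical
  obtain ⟨p, hp⟩ := h a ha b hb
  exact ⟨p.bypass, p.bypass_isPath, fun x hx => hp x (p.support_bypass_subset_support hx)⟩

lemma isPath_support_subset_of_isAcyclic (hG : G.IsAcyclic) {a b : W} {p : G.Walk a b}
    (hp : p.IsPath) (q : G.Walk a b) {x : W} (hx : x ∈ p.support) : x ∈ q.support := by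
  classical
  have : p = q.bypass := 
    congrArg Subtype.val ((hG.subsingleton_path a b).elim ⟨p, hp⟩ ⟨q.bypass, q.bypass_isPath⟩)
  exact q.support_bypass_subset_support (this ▸ hx)

/-- In a tree the unique path between two vertices lies in every connected set containing both. -/
lemma WalkConnected.iInter (hG : G.IsTree) {ι : Type*} {S : ι → Set W}
    (h : ∀ i, WalkConnected G (S i)) : WalkConnected G (⋂ i, S i) := by
  intro a ha b hb
  obtain ⟨p, hp, -⟩ := hG.existsUnique_path a b
  refine ⟨p, fun x hx => Set.mem_iInter.2 fun i => ?_⟩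
  obtain ⟨q, hq⟩ := h i a (Set.mem_iInter.1 ha i) b (Set.mem_iInter.1 hb i)
  exact hq x (isPath_support_subset_of_isAcyclic hG.isAcyclic hp q hx)

/-- A connected set `S` in a tree has a gate towards any vertex `c`: a vertex of `S` through which
all walks from `S` to `c` pass. -/
lemma WalkConnected.exists_gate (hG : G.IsTree) {S : Set W} (hS : WalkConnected G S)
    (hne : S.Nonempty) (c : W) : ∃ m ∈ S, ∀ s ∈ S, ∀ q : G.Walk s c, m ∈ q.support := by
  classical
  -- The gate is a vertex of `S` nearest to `c`. A geodesic from it to `c` never returns to `S`, so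
  -- prefixing a path inside `S` yields the unique path to `c`, which every walk must contain.
  obtain ⟨m, hm, hmin⟩ : ∃ m ∈ S, ∀ s ∈ S, G.dist m c ≤ G.dist s c := by
    obtain ⟨m, hm⟩ := exists_minimalFor_of_wellFoundedLT (· ∈ S) (fun s => G.dist s c) hne
    exact ⟨m, hm.1, fun s hs => (le_total _ _).elim id fun h => hm.2 hs h⟩
  refine ⟨m, hm, fun s hs q => ?_⟩
  obtain ⟨p, hp, hpS⟩ := hS.exists_isPath hs hm
  obtain ⟨r, hr, hlen⟩ := hG.connected.exists_path_of_dist m c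
  have hrS : ∀ x ∈ r.support, x ∈ S → x = m := by
    intro x hx hxS
    by_contra hne
    have h1 := hmin x hxS
    have h2 := SimpleGraph.dist_le (r.dropUntil x hx)
    have h3 := congrArg SimpleGraph.Walk.length (r.take_spec hx)
    rw [SimpleGraph.Walk.length_append] at h3
    have h4 : (r.takeUntil x hx).length ≠ 0 := fun h0 =>
      hne (SimpleGraph.Walk.eq_of_length_eq_zero h0).symm
    omega
  have hpath : (p.append r).IsPath := by
    have hr' := hr.support_nodup
    rw [← r.cons_tail_support, List.nodup_cons] at hr'
    rw [SimpleGraph.Walk.isPath_def, SimpleGraph.Walk.support_append, List.nodup_append']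
    refine ⟨hp.support_nodup, hr'.2, fun x hx hx' => hr'.1 ?_⟩
    rwa [hrS x (List.mem_of_mem_tail hx') (hpS x hx)] at hx'
  exact isPath_support_subset_of_isAcyclic hG.isAcyclic hpath q
    (SimpleGraph.Walk.mem_support_append_iff _ _ |>.2 (Or.inl p.end_mem_support))

end Trees

variable {V : Type*} [DecidableEq V] {edges : Multiset (Finset V)}

/-- In a tree decomposition of a "blown-up" 4-cycle, some bag contains three consecutive blocks. -/
lemma TreeDecomposition.exists_three_blocks (T : TreeDecomposition edges) (B : Fin 4 → Finset V)
    (hB : ∀ i, ∃ F ∈ edges, B i ∪ B (i + 1) ⊆ F) :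
    ∃ i t, B i ∪ B (i + 1) ∪ B (i + 2) ⊆ T.bag t := by
  let S (i : Fin 4) : Set (Fin T.size) := {t | B i ⊆ T.bag t}
  have hS (i : Fin 4) : WalkConnected T.tree (S i) := by
    have : S i = ⋂ v : B i, {t | (v : V) ∈ T.bag t} := by
      ext t
      simp [S, Finset.subset_iff]
    rw [this]
    exact WalkConnected.iInter T.isTree fun v =>
      walkConnected_of_preconnected (T.subtree v).preconnected
  have hmeet (i : Fin 4) : ∃ t, t ∈ S i ∧ t ∈ S (i + 1) := by
    obtain ⟨F, hF, hsub⟩ := hB i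
    obtain ⟨t, ht⟩ := T.edge_subset F hF
    exact ⟨t, Finset.union_subset_iff.1 (hsub.trans ht)⟩
  obtain ⟨a, ha₀, ha₁⟩ := hmeet 0
  obtain ⟨b, hb₁, hb₂⟩ := hmeet 1
  obtain ⟨c, hc₂, hc₃⟩ := hmeet 2
  obtain ⟨d, hd₃, hd₀⟩ := hmeet 3
  -- Let `m` be the gate of `S 1` towards `c`. The walk from `b` to `c` inside `S 2` puts `m` in `S
  -- 2`; the walk from `a` through `d` to `c`, inside `S 0` and then `S 3`, puts it in one of these
  -- two.
  obtain ⟨m, hm₁, hm⟩ := (hS 1).exists_gate T.isTree ⟨a, ha₁⟩ c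
  obtain ⟨p, hp⟩ := hS 2 b hb₂ c hc₂
  have hm₂ : m ∈ S 2 := hp m (hm b hb₁ p)
  obtain ⟨q, hq⟩ := hS 0 a ha₀ d hd₀
  obtain ⟨r, hr⟩ := hS 3 d hd₃ c hc₃
  rcases (SimpleGraph.Walk.mem_support_append_iff _ _).1 (hm a ha₁ (q.append r)) with h | h
  · exact ⟨0, m, Finset.union_subset (Finset.union_subset (hq m h) hm₁) hm₂⟩
  · exact ⟨1, m, Finset.union_subset (Finset.union_subset hm₁ hm₂) (hr m h)⟩

/-- The tree decomposition with two bags `P` and `Q`. -/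
def TreeDecomposition.pair [Fintype V] (P Q : Finset V) (hPQ : P ∪ Q = Finset.univ)
    (h : ∀ F ∈ edges, F ⊆ P ∨ F ⊆ Q) : TreeDecomposition edges where
  size := 2
  tree := ⊤
  isTree := ⟨SimpleGraph.connected_top, SimpleGraph.IsAcyclic.of_card_le_two (by simp)⟩
  bag := ![P, Q]
  edge_subset F hF := (h F hF).elim (fun h => ⟨0, h⟩) (fun h => ⟨1, h⟩)
  subtree v := by
    -- Connectedness includes nonemptiness, so every variable must occur in a bag.
    have : Nonempty {t : Fin 2 | v ∈ ![P, Q] t} := by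
      rcases Finset.mem_union.1 (hPQ ▸ Finset.mem_univ v) with h | h
      · exact ⟨0, h⟩
      · exact ⟨1, h⟩
    rw [SimpleGraph.induce_top]
    exact SimpleGraph.connected_top

lemma exists_treeDecomposition_univ [Fintype V] (edges : Multiset (Finset V)) :
    ∃ T : TreeDecomposition edges, ∀ t, T.bag t = Finset.univ :=
  ⟨.pair Finset.univ Finset.univ (by simp) fun F _ => .inl (Finset.subset_univ F),
    Fin.forall_fin_two.2 ⟨rfl, rfl⟩⟩

/-! ### Widths -/

lemma log2_natCast {N : ℕ} (hN : N ≠ 0) : log2 (N : ℕ∞) = ((Real.logb 2 N : ℝ) : EReal) := by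
  simp [log2, hN]

lemma log2_one : log2 1 = ((0 : ℝ) : EReal) := by
  have := log2_natCast one_ne_zero
  simpa using this

lemma log2_mono : Monotone log2 := by
  intro a b hab
  by_cases hb : b = ⊤
  · simp [log2, hb]
  by_cases ha : a = 0
  · simp [log2, ha]
  lift b to ℕ using hb
  lift a to ℕ using ne_top_of_le_ne_top (ENat.natCast_ne_top b) hab
  have hab : a ≤ b := by exact_mod_cast hab
  have ha : 0 < a := Nat.pos_of_ne_zero (by exact_mod_cast ha)
  rw [log2_natCast ha.ne', log2_natCast (ha.trans_le hab).ne', EReal.coe_le_coe_iff]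
  exact Real.logb_le_logb_of_le one_lt_two (by exact_mod_cast ha) (by exact_mod_cast hab)

section General

variable {V : Type*} {𝓕 𝓖 : Set (Finset V → ℝ)} {Q : Query V}

lemma maximinWidth_le_minimaxWidth : maximinWidth 𝓕 Q ≤ minimaxWidth 𝓕 Q :=
  iSup₂_le fun h hh => le_iInf fun T => (iInf_le _ T).trans <|
    iSup_mono fun _ => le_iSup₂_of_le h hh le_rfl

lemma minimaxWidth_mono (h : 𝓕 ⊆ 𝓖) : minimaxWidth 𝓕 Q ≤ minimaxWidth 𝓖 Q :=
  iInf_mono fun _ => iSup_mono fun _ => biSup_mono h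

lemma maximinWidth_mono (h : 𝓕 ⊆ 𝓖) : maximinWidth 𝓕 Q ≤ maximinWidth 𝓖 Q :=
  biSup_mono h

lemma minimaxWidth_le [Fintype V] [DecidableEq V] {b : EReal}
    (h : ∀ f ∈ 𝓕, (f Finset.univ : EReal) ≤ b) : minimaxWidth 𝓕 Q ≤ b := by
  obtain ⟨T, hT⟩ := exists_treeDecomposition_univ Q.edges
  exact (iInf_le _ T).trans <| iSup_le fun t => iSup₂_le fun f hf => by
    rw [hT]; exact h f hf

lemma le_minimaxWidth {b : EReal}
    (h : ∀ T : TreeDecomposition Q.edges, ∃ t, ∃ f ∈ 𝓕, b ≤ (f (T.bag t) : EReal)) :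
    b ≤ minimaxWidth 𝓕 Q :=
  le_iInf fun T => by
    obtain ⟨t, f, hf, hb⟩ := h T
    exact le_iSup_of_le t (le_iSup₂_of_le f hf hb)

lemma maximinWidth_le {b : EReal}
    (h : ∀ f ∈ 𝓕, ∃ T : TreeDecomposition Q.edges, ∀ t, (f (T.bag t) : EReal) ≤ b) :
    maximinWidth 𝓕 Q ≤ b :=
  iSup₂_le fun f hf => by
    obtain ⟨T, hT⟩ := h f hf
    exact (iInf_le _ T).trans (iSup_le hT)

lemma le_maximinWidth {b : EReal} {f : Finset V → ℝ} (hf : f ∈ 𝓕)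
    (h : ∀ T : TreeDecomposition Q.edges, ∃ t, b ≤ (f (T.bag t) : EReal)) :
    b ≤ maximinWidth 𝓕 Q :=
  le_iSup₂_of_le f hf <| le_iInf fun T => by
    obtain ⟨t, ht⟩ := h T
    exact le_iSup_of_le t ht

/-- An atom on all variables forces a full bag in every decomposition. -/
lemma le_maximinWidth_of_univ_mem [Fintype V] (hQ : Finset.univ ∈ Q.edges)
    {f : Finset V → ℝ} (hf : f ∈ 𝓕) : (f Finset.univ : EReal) ≤ maximinWidth 𝓕 Q :=
  le_maximinWidth hf fun T => by
    obtain ⟨t, ht⟩ := T.edge_subset _ hQ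
    exact ⟨t, by rw [Finset.univ_subset_iff.1 ht]⟩

variable [DecidableEq V]

lemma edaSubw_le_edaFhtw (Q : Query V) : edaSubw Q ≤ edaFhtw Q := maximinWidth_le_minimaxWidth

lemma daSubw_le_daFhtw (Q : Query V) : daSubw Q ≤ daFhtw Q := maximinWidth_le_minimaxWidth

variable [Fintype V]

lemma closure_entropic_inter_subset (Q : Query V) :
    closure (entropic V) ∩ HDC Q ⊆ polymatroids V ∩ HDC Q :=
  Set.inter_subset_inter_left _ (closure_entropic_subset.trans Set.inter_subset_left)

lemma edaFhtw_le_daFhtw (Q : Query V) : edaFhtw Q ≤ daFhtw Q :=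
  minimaxWidth_mono (closure_entropic_inter_subset Q)

lemma edaSubw_le_daSubw (Q : Query V) : edaSubw Q ≤ daSubw Q :=
  maximinWidth_mono (closure_entropic_inter_subset Q)

lemma zero_mem_entropic : (fun _ => 0 : Finset V → ℝ) ∈ entropic V := by
  simpa using sum_logb_mem_entropic (V := V) (fun _ => 1) (fun _ => one_pos)

/-- This excludes the value `-∞`: the zero function is feasible unless some bound is `0`, where
`log2` is `⊥`. -/
lemma zero_le_edaSubw (hQ : ∀ c ∈ Q.constraints, c.bound ≠ 0) : 0 ≤ edaSubw Q := by
  refine le_maximinWidth (f := fun _ => 0) ⟨subset_closure zero_mem_entropic, fun c hc => ?_⟩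
    fun T => ?_
  · rw [sub_zero, ← log2_one]
    exact log2_mono (Order.one_le_iff_ne_zero.2 (hQ c hc))
  · obtain ⟨t⟩ := T.isTree.connected.nonempty
    exact ⟨t, le_rfl⟩

end General

lemma GapAtLeast.of_bounds {a b : EReal} {α β γ C : ℝ} (ha : 0 ≤ a) (haα : a ≤ α) (hβb : β ≤ b)
    (hbγ : b ≤ γ) (h : α + C ≤ β) : GapAtLeast C a b := by
  lift a to ℝ using ⟨ne_top_of_le_ne_top (EReal.coe_ne_top α) haα,
    ne_bot_of_le_ne_bot EReal.zero_ne_bot ha⟩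
  lift b to ℝ using ⟨ne_top_of_le_ne_top (EReal.coe_ne_top γ) hbγ,
    ne_bot_of_le_ne_bot (EReal.coe_ne_bot β) hβb⟩
  rw [EReal.coe_le_coe_iff] at haα hβb
  exact ⟨a, b, rfl, rfl, by linarith⟩

/-! ### Disjoint copies of a query -/

section Copies

variable {V : Type*}

/-- The image of a degree constraint under an embedding of the variables. -/
def DegreeConstraint.map {W : Type*} (e : V ↪ W) (c : DegreeConstraint V) : DegreeConstraint W :=
  ⟨c.src.map e, c.tgt.map e, Finset.map_ssubset_map.2 c.src_ssubset_tgt, c.bound⟩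

/-- The query with `k` copies of every variable: each atom contains all copies of its variables,
and the degree constraints hold for each copy separately. -/
def Query.copies (Q : Query V) (k : ℕ) : Query (V × Fin k) where
  edges := Q.edges.map (· ×ˢ Finset.univ)
  constraints := ⋃ l, DegreeConstraint.map (Function.Embedding.sectL V l) '' Q.constraints
  finite_constraints := Set.finite_iUnion fun _ => Q.finite_constraints.image _
  guarded := by
    simp only [Set.mem_iUnion, Set.mem_image]
    rintro _ ⟨l, c, hc, rfl⟩
    obtain ⟨F, hF, hcF⟩ := Q.guarded c hc
    refine ⟨_, Multiset.mem_map_of_mem _ hF, fun x hx => ?_⟩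
    obtain ⟨v, hv, rfl⟩ := Finset.mem_map.1 hx
    simpa using hcF hv

/-- The restriction of a set function to the copy `l`. -/
def layer {k : ℕ} (h : Finset (V × Fin k) → ℝ) (l : Fin k) (S : Finset V) : ℝ :=
  h (S.map (Function.Embedding.sectL V l))

variable {k : ℕ} {Q : Query V}

lemma mem_HDC_copies {h : Finset (V × Fin k) → ℝ} :
    h ∈ HDC (Q.copies k) ↔ ∀ l, layer h l ∈ HDC Q := by
  simp only [HDC, Query.copies, Set.mem_iUnion, Set.mem_image, Set.mem_ofPred_eq]
  exact ⟨fun H l c hc => H _ ⟨l, c, hc, rfl⟩, fun H _ ⟨l, c, hc, e⟩ => e ▸ H l c hc⟩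

lemma Query.forall_bound_copies {p : ℕ∞ → Prop} (h : ∀ c ∈ Q.constraints, p c.bound) :
    ∀ c ∈ (Q.copies k).constraints, p c.bound := by
  simp only [Query.copies, Set.mem_iUnion, Set.mem_image]
  rintro _ ⟨l, c, hc, rfl⟩
  exact h c hc

variable [DecidableEq V]

lemma layer_mem_polymatroids {h : Finset (V × Fin k) → ℝ} (hh : h ∈ polymatroids (V × Fin k))
    (l : Fin k) : layer h l ∈ polymatroids V := by
  obtain ⟨h1, h2, h3, h4⟩ := hh
  refine ⟨fun S => h1 _, by simpa [layer] using h2,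
    fun X Y hXY => h3 _ _ (Finset.map_subset_map.2 hXY),
    fun X Y => ?_⟩
  simpa only [layer, Finset.map_union, Finset.map_inter] using h4 (X.map _) (Y.map _)

lemma layer_mem_zhangYeung {h : Finset (V × Fin k) → ℝ} (hh : h ∈ zhangYeung (V × Fin k))
    (l : Fin k) : layer h l ∈ zhangYeung V := by
  intro A B X Y
  simpa only [layer, Finset.map_union] using hh (A.map _) (B.map _) (X.map _) (Y.map _)

lemma polymatroid_biUnion_le {W ι : Type*} [DecidableEq W] {h : Finset W → ℝ}
    (hh : h ∈ polymatroids W) (s : Finset ι) (f : ι → Finset W) :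
    h (s.biUnion f) ≤ ∑ i ∈ s, h (f i) := by
  classical
  induction s using Finset.induction_on with
  | empty => simp [hh.2.1]
  | insert i s hi ih =>
    rw [Finset.biUnion_insert, Finset.sum_insert hi]
    linarith [hh.2.2.2 (f i) (s.biUnion f), hh.1 (f i ∩ s.biUnion f)]

/-- Subadditivity over the layers: an upper bound for `Q` becomes at most `k` times that bound for
`Q.copies k`. -/
lemma polymatroid_prod_le_sum_layer {h : Finset (V × Fin k) → ℝ}
    (hh : h ∈ polymatroids (V × Fin k)) (S : Finset V) :
    h (S ×ˢ Finset.univ) ≤ ∑ l, layer h l S := by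
  have : S ×ˢ (Finset.univ : Finset (Fin k)) =
      Finset.univ.biUnion fun l => S.map (Function.Embedding.sectL V l) := by
    ext ⟨v, l⟩
    simp
  rw [this]
  exact polymatroid_biUnion_le hh _ _

/-- The part of a set of variables that lies in the copy `l`. -/
def slice (S : Finset (V × Fin k)) (l : Fin k) : Finset V :=
  (S.filter (·.2 = l)).image Prod.fst

@[simp]
lemma mem_slice {S : Finset (V × Fin k)} {l : Fin k} {v : V} : v ∈ slice S l ↔ (v, l) ∈ S := by
  simp [slice]

/-- The direct sum of `k` copies of a set function. -/
def sumLayers (k : ℕ) (f : Finset V → ℝ) (S : Finset (V × Fin k)) : ℝ :=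
  ∑ l, f (slice S l)

/-- A set inside copy `l` has empty slices elsewhere. Hence the direct sum satisfies the constraints
of every copy as soon as `f` does. -/
lemma layer_sumLayers {f : Finset V → ℝ} (hf : f ∅ = 0) (l : Fin k) :
    layer (sumLayers k f) l = f := by
  ext S
  rw [layer, sumLayers, Finset.sum_eq_single l]
  · congr 1
    ext v
    simp
  · intro l' _ hl
    convert hf
    ext v
    simp [hl.symm]
  · simp

lemma sumLayers_mem_polymatroids {f : Finset V → ℝ} (hf : f ∈ polymatroids V) :
    sumLayers k f ∈ polymatroids (V × Fin k) := by
  obtain ⟨h1, h2, h3, h4⟩ := hf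
  refine ⟨fun S => Finset.sum_nonneg fun l _ => h1 _, ?_, fun X Y hXY => ?_, fun X Y => ?_⟩
  · simp [sumLayers, slice, h2]
  · exact Finset.sum_le_sum fun l _ => h3 _ _ fun v hv => mem_slice.2 (hXY (mem_slice.1 hv))
  · simp only [sumLayers, ← Finset.sum_add_distrib]
    refine Finset.sum_le_sum fun l _ => ?_
    have hu : slice (X ∪ Y) l = slice X l ∪ slice Y l := by ext; simp
    have hi : slice (X ∩ Y) l = slice X l ∩ slice Y l := by ext; simp
    rw [hu, hi]
    exact h4 _ _

lemma sumLayers_univ [Fintype V] (f : Finset V → ℝ) :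
    sumLayers k f Finset.univ = k * f Finset.univ := by
  have (l : Fin k) : slice (Finset.univ : Finset (V × Fin k)) l = Finset.univ := by ext; simp
  simp [sumLayers, this]

end Copies

/-! ### The 4-cycle -/

/-- The variables of `Q` are covered by four blocks, arranged in a 4-cycle whose edges are the
edges of `Q`; `L` is the best bound on the entropy of an edge. -/
structure FourCycleBlocks {W : Type*} [DecidableEq W] (Q : Query W) (B : Fin 4 → Finset W)
    (L : ℝ) : Prop where
  cover : ∀ v, ∃ i, v ∈ B i
  edge_subset : ∀ F ∈ Q.edges, ∃ i, F ⊆ B i ∪ B (i + 1)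
  subset_edge : ∀ i, ∃ F ∈ Q.edges, B i ∪ B (i + 1) ⊆ F
  bound : ∀ h ∈ polymatroids W ∩ HDC Q, ∀ i, h (B i ∪ B (i + 1)) ≤ L
  exists_entropic : ∀ i, ∃ h ∈ entropic W ∩ HDC Q, 2 * L ≤ h (B i ∪ B (i + 2))

namespace FourCycleBlocks

variable {W : Type*} [Fintype W] [DecidableEq W] {Q : Query W} {B : Fin 4 → Finset W} {L : ℝ}

lemma daFhtw_le (H : FourCycleBlocks Q B L) : daFhtw Q ≤ ((2 * L : ℝ) : EReal) := by
  refine minimaxWidth_le fun h hh => EReal.coe_le_coe_iff.2 ?_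
  have hcover : (B 0 ∪ B 1) ∪ (B 2 ∪ B 3) = Finset.univ := by
    refine Finset.eq_univ_of_forall fun v => ?_
    obtain ⟨i, hi⟩ := H.cover v
    fin_cases i <;> simp_all
  have h1 := H.bound h hh 0
  have h2 := H.bound h hh 2
  have h3 := hh.1.2.2.2 (B 0 ∪ B 1) (B 2 ∪ B 3)
  have h4 := hh.1.1 ((B 0 ∪ B 1) ∩ (B 2 ∪ B 3))
  rw [hcover] at h3
  simp only [zero_add, Fin.reduceAdd] at h1 h2
  linarith

lemma le_edaFhtw (H : FourCycleBlocks Q B L) : ((2 * L : ℝ) : EReal) ≤ edaFhtw Q := by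
  refine le_minimaxWidth fun T => ?_
  obtain ⟨i, t, hsub⟩ := T.exists_three_blocks B H.subset_edge
  obtain ⟨h, hh, hL⟩ := H.exists_entropic i
  have hc : h ∈ closure (entropic W) := subset_closure hh.1
  refine ⟨t, h, ⟨hc, hh.2⟩, EReal.coe_le_coe_iff.2 (hL.trans ?_)⟩
  refine (closure_entropic_subset hc).1.2.2.1 _ _ (Finset.Subset.trans ?_ hsub)
  exact Finset.union_subset_union_left Finset.subset_union_left

lemma edaFhtw_eq (H : FourCycleBlocks Q B L) : edaFhtw Q = ((2 * L : ℝ) : EReal) :=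
  le_antisymm ((edaFhtw_le_daFhtw Q).trans H.daFhtw_le) H.le_edaFhtw

/-- Cut the cycle along the diagonal joining blocks `i` and `i + 2`. -/
lemma exists_treeDecomposition (H : FourCycleBlocks Q B L) (i : Fin 4) :
    ∃ T : TreeDecomposition Q.edges, ∀ t, T.bag t = B i ∪ B (i + 1) ∪ B (i + 2) ∨
      T.bag t = B (i + 2) ∪ B (i + 2 + 1) ∪ B (i + 2 + 2) := by
  have hi : i + 2 + 2 = i := by revert i; decide
  have hj (j : Fin 4) : j = i ∨ j = i + 1 ∨ j = i + 2 ∨ j = i + 2 + 1 := by revert i j; decide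
  have h1 : i + 1 + 1 = i + 2 := by revert i; decide
  have h2 : i + 2 + 1 + 1 = i := by revert i; decide
  refine ⟨.pair (B i ∪ B (i + 1) ∪ B (i + 2)) (B (i + 2) ∪ B (i + 2 + 1) ∪ B (i + 2 + 2)) ?_ ?_,
    Fin.forall_fin_two.2 ⟨.inl rfl, .inr rfl⟩⟩
  · refine Finset.eq_univ_of_forall fun v => ?_
    obtain ⟨j, hv⟩ := H.cover v
    rcases hj j with rfl | rfl | rfl | rfl <;> simp [hv]
  · intro F hF
    obtain ⟨j, hFj⟩ := H.edge_subset F hF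
    rcases hj j with rfl | rfl | rfl | rfl
    · exact .inl (hFj.trans Finset.subset_union_left)
    · refine .inl (hFj.trans ?_)
      rw [h1, Finset.union_assoc]
      exact Finset.subset_union_right
    · exact .inr (hFj.trans Finset.subset_union_left)
    · refine .inr (hFj.trans ?_)
      rw [h2, hi, Finset.union_assoc]
      exact Finset.subset_union_right

lemma daSubw_le (H : FourCycleBlocks Q B L) : daSubw Q ≤ ((3 / 2 * L : ℝ) : EReal) := by
  refine maximinWidth_le fun h hh => ?_
  -- Glue the first two edges along `B (i + 1)`, then spend the `h (B (i + 1))` thereby gained on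
  -- adding that block to the third edge.
  have key (i : Fin 4) : h (B i ∪ B (i + 1) ∪ B (i + 2)) +
      h (B (i + 1) ∪ B (i + 1 + 1) ∪ B (i + 1 + 2)) ≤ 3 * L := by
    have e1 : i + 1 + 1 = i + 2 := by revert i; decide
    have e2 : i + 1 + 2 = i + 2 + 1 := by revert i; decide
    rw [e1, e2]
    have b1 := H.bound h hh i
    have b2 := H.bound h hh (i + 1)
    have b3 := H.bound h hh (i + 2)
    rw [e1] at b2
    obtain ⟨⟨hnn, -, hmono, hsub⟩, -⟩ := hh
    have s1 := hsub (B i ∪ B (i + 1)) (B (i + 1) ∪ B (i + 2))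
    have s2 := hsub (B (i + 1)) (B (i + 2) ∪ B (i + 2 + 1))
    have m : h (B (i + 1)) ≤ h ((B i ∪ B (i + 1)) ∩ (B (i + 1) ∪ B (i + 2))) :=
      hmono _ _ (Finset.subset_inter Finset.subset_union_right Finset.subset_union_left)
    have n := hnn (B (i + 1) ∩ (B (i + 2) ∪ B (i + 2 + 1)))
    have u1 : (B i ∪ B (i + 1)) ∪ (B (i + 1) ∪ B (i + 2)) = B i ∪ B (i + 1) ∪ B (i + 2) := by
      ext; simp only [Finset.mem_union]; tauto
    rw [u1] at s1
    rw [← Finset.union_assoc] at s2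
    linarith
  -- If both diagonals failed, each would have a triple above `3/2 L`. Triples from different
  -- diagonals are adjacent, contradicting `key`.
  have split : ∃ i : Fin 4, h (B i ∪ B (i + 1) ∪ B (i + 2)) ≤ 3 / 2 * L ∧
      h (B (i + 2) ∪ B (i + 2 + 1) ∪ B (i + 2 + 2)) ≤ 3 / 2 * L := by
    have k0 := key 0
    have k1 := key 1
    have k2 := key 2
    have k3 := key 3
    by_contra! hcon
    have c0 := hcon 0
    have c1 := hcon 1
    simp only [zero_add, Fin.reduceAdd] at k0 k1 k2 k3 c0 c1
    rcases le_or_gt (h (B 0 ∪ B 1 ∪ B 2)) (3 / 2 * L) with d0 | d0 <;>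
    rcases le_or_gt (h (B 1 ∪ B 2 ∪ B 3)) (3 / 2 * L) with d1 | d1
    · linarith [c0 d0, c1 d1]
    · linarith [c0 d0]
    · linarith [c1 d1]
    · linarith
  obtain ⟨i, h1, h2⟩ := split
  obtain ⟨T, hT⟩ := H.exists_treeDecomposition i
  refine ⟨T, fun t => EReal.coe_le_coe_iff.2 ?_⟩
  rcases hT t with h | h <;> rw [h] <;> assumption

end FourCycleBlocks

section FourCycle

variable {N : ℕ}

lemma mem_HDC_fourCycle (hN : N ≠ 0) {h : Finset (Fin 4) → ℝ} (h0 : h ∅ = 0) :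
    h ∈ HDC (fourCycle N) ↔ ∀ i : Fin 4, h {i, i + 1} ≤ Real.logb 2 N := by
  simp [HDC, fourCycle, DegreeConstraint.card, log2_natCast hN, h0, Fin.forall_fin_succ,
    -EReal.coe_sub]

lemma sum_logb_mem_HDC_fourCycle (hN : N ≠ 0) (i : Fin 4) :
    (fun S : Finset (Fin 4) => ∑ v ∈ S, Real.logb 2 ((if v = i ∨ v = i + 2 then N else 1 : ℕ) : ℝ))
      ∈ HDC (fourCycle N) := by
  rw [mem_HDC_fourCycle hN Finset.sum_empty]
  intro j
  have hj : j ≠ j + 1 := by revert j; decide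
  rw [Finset.sum_pair hj]
  -- Every edge of the cycle contains exactly one of `i`, `i + 2`.
  have : (j = i ∨ j = i + 2) ↔ ¬ (j + 1 = i ∨ j + 1 = i + 2) := by revert i j; decide
  by_cases h : j + 1 = i ∨ j + 1 = i + 2 <;> simp [this, h]

lemma fourCycleBlocks_fourCycle (hN : N ≠ 0) :
    FourCycleBlocks (fourCycle N) (fun i => {i}) (Real.logb 2 N) where
  cover v := ⟨v, by simp⟩
  edge_subset F hF := by
    simp only [fourCycle, Multiset.insert_eq_cons, Multiset.mem_cons, Multiset.mem_singleton] at hF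
    rcases hF with rfl | rfl | rfl | rfl
    exacts [⟨0, by decide⟩, ⟨1, by decide⟩, ⟨2, by decide⟩, ⟨3, by decide⟩]
  subset_edge i := ⟨{i, i + 1}, by fin_cases i <;> simp [fourCycle], by revert i; decide⟩
  bound h hh i := (mem_HDC_fourCycle hN hh.1.2.1).1 hh.2 i
  exists_entropic i := by
    refine ⟨_, ⟨sum_logb_mem_entropic (fun v => if v = i ∨ v = i + 2 then N else 1) fun v => ?_,
      sum_logb_mem_HDC_fourCycle hN i⟩, ?_⟩
    · split_ifs <;> omega
    · have hi : i ≠ i + 2 := by revert i; decide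
      change _ ≤ ∑ v ∈ {i, i + 2}, _
      rw [Finset.sum_pair hi]
      simp [two_mul]

lemma le_daSubw_fourCycle (hN : N ≠ 0) :
    ((3 / 2 * Real.logb 2 N : ℝ) : EReal) ≤ daSubw (fourCycle N) := by
  have hlog : 0 ≤ Real.logb 2 N :=
    Real.logb_nonneg one_lt_two (by exact_mod_cast Nat.one_le_iff_ne_zero.2 hN)
  refine le_maximinWidth (f := fun S => S.card / 2 * Real.logb 2 N) 
    ⟨⟨fun S => by positivity, by simp, fun X Y hXY => ?_, fun X Y => ?_⟩,
      (mem_HDC_fourCycle hN (by simp)).2 fun i => ?_⟩ fun T => ?_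
  · have := Finset.card_le_card hXY
    change (X.card : ℝ) / 2 * _ ≤ Y.card / 2 * _
    gcongr
  · have : ((X ∪ Y).card : ℝ) + (X ∩ Y).card = X.card + Y.card := by
      exact_mod_cast Finset.card_union_add_card_inter X Y
    exact le_of_eq (by linear_combination (Real.logb 2 N / 2) * this)
  · have : ({i, i + 1} : Finset (Fin 4)).card = 2 := by revert i; decide
    simp [this]
  · obtain ⟨i, t, ht⟩ :=
      T.exists_three_blocks (fun i => {i}) (fourCycleBlocks_fourCycle hN).subset_edge
    have h3 : ∀ i : Fin 4, ({i} ∪ {i + 1} ∪ {i + 2} : Finset (Fin 4)).card = 3 := by decide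
    have := Finset.card_le_card ht
    rw [h3] at this
    have : (3 : ℝ) ≤ (T.bag t).card := by exact_mod_cast this
    refine ⟨t, EReal.coe_le_coe_iff.2 ?_⟩
    gcongr

lemma fourCycleBlocks_copies (hN : N ≠ 0) (k : ℕ) :
    FourCycleBlocks ((fourCycle N).copies k) (fun i => {i} ×ˢ Finset.univ)
      (k * Real.logb 2 N) where
  cover v := ⟨v.1, by simp⟩
  edge_subset F hF := by
    simp only [Query.copies, Multiset.mem_map] at hF
    obtain ⟨F', hF', rfl⟩ := hF
    obtain ⟨i, hi⟩ := (fourCycleBlocks_fourCycle hN).edge_subset F' hF'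
    exact ⟨i, by rw [← Finset.union_product]; exact Finset.product_subset_product_left hi⟩
  subset_edge i := by
    obtain ⟨F, hF, hi⟩ := (fourCycleBlocks_fourCycle hN).subset_edge i
    exact ⟨_, Multiset.mem_map_of_mem _ hF,
      by rw [← Finset.union_product]; exact Finset.product_subset_product_left hi⟩
  bound h hh i := by
    rw [← Finset.union_product]
    refine (polymatroid_prod_le_sum_layer hh.1 _).trans ?_
    refine (Finset.sum_le_card_nsmul _ _ (Real.logb 2 N) fun l _ => ?_).trans (by simp)
    exact (fourCycleBlocks_fourCycle hN).bound _
      ⟨layer_mem_polymatroids hh.1 l, mem_HDC_copies.1 hh.2 l⟩ i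
  exists_entropic i := by
    refine ⟨_, ⟨sum_logb_mem_entropic (fun v => if v.1 = i ∨ v.1 = i + 2 then N else 1) fun v => ?_,
      mem_HDC_copies.2 fun l => ?_⟩, ?_⟩
    · split_ifs <;> omega
    · convert sum_logb_mem_HDC_fourCycle hN i using 1
      ext S
      simp [layer]
    · have hi : i ≠ i + 2 := by revert i; decide
      rw [← Finset.union_product, Finset.sum_product]
      change _ ≤ ∑ v ∈ {i, i + 2}, _
      rw [Finset.sum_pair hi]
      simp [two_mul]

end FourCycle

/-! ### The augmented Zhang–Yeung query -/

section ZhangYeungPlus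

variable {N : ℕ} {M : ℕ∞}

lemma mem_HDC_zhangYeungPlus (hN : N ≠ 0) {h : Finset (Fin 5) → ℝ} (h0 : h ∅ = 0) :
    h ∈ HDC (zhangYeungPlus N M) ↔
      (h {2, 3} ≤ 3 * Real.logb 2 N ∧ h {0, 2} ≤ 3 * Real.logb 2 N ∧
        h {0, 3} ≤ 3 * Real.logb 2 N ∧ h {1, 2} ≤ 3 * Real.logb 2 N ∧
        h {1, 3} ≤ 3 * Real.logb 2 N ∧ h {4} ≤ 2 * Real.logb 2 N) ∧
      (h Finset.univ ≤ h {0, 1} ∧ h Finset.univ ≤ h {0, 2, 3} ∧ h Finset.univ ≤ h {1, 2, 3} ∧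
        h Finset.univ ≤ h {0, 4} ∧ h Finset.univ ≤ h {2, 4} ∧ h Finset.univ ≤ h {3, 4}) ∧
      (h Finset.univ : EReal) ≤ log2 M := by
  have h3 : log2 ((N ^ 3 : ℕ) : ℕ∞) = ((3 * Real.logb 2 N : ℝ) : EReal) := by
    rw [log2_natCast (pow_ne_zero _ hN)]; simp [Real.logb_pow]
  have h2 : log2 ((N ^ 2 : ℕ) : ℕ∞) = ((2 * Real.logb 2 N : ℝ) : EReal) := by
    rw [log2_natCast (pow_ne_zero _ hN)]; simp [Real.logb_pow]
  simp only [HDC, zhangYeungPlus, DegreeConstraint.card, DegreeConstraint.fd, h3, h2, log2_one,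
    Set.mem_ofPred_eq, Set.mem_insert_iff, Set.mem_singleton_iff, forall_eq_or_imp, forall_eq, h0,
    sub_zero, EReal.coe_le_coe_iff, sub_nonpos, and_assoc]

/-- With `L = log N` and `H = h(V)`, the keys and cardinalities turn Zhang–Yeung into `6H + h(A) +
2h(X) + 2h(Y) ≤ 33L`. The keys `AC, XC, YC` give `h(A), h(X), h(Y) ≥ H - 2L`, hence `11H ≤ 43L`. -/
lemma univ_le_of_mem_HDC_zhangYeungPlus (hN : N ≠ 0) {h : Finset (Fin 5) → ℝ}
    (hp : h ∈ polymatroids (Fin 5)) (hz : h ∈ zhangYeung (Fin 5))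
    (hQ : h ∈ HDC (zhangYeungPlus N M)) : h Finset.univ ≤ 43 / 11 * Real.logb 2 N := by
  obtain ⟨⟨c1, c2, c3, c4, c5, c6⟩, ⟨k1, k2, k3, k4, k5, k6⟩, -⟩ :=
    (mem_HDC_zhangYeungPlus hN hp.2.1).1 hQ
  have z : h {0, 1} + 4 * h {0, 2, 3} + h {1, 2, 3} + h {0} + 2 * h {2} + 2 * h {3} ≤
      3 * h {2, 3} + 3 * h {0, 2} + 3 * h {0, 3} + h {1, 2} + h {1, 3} := hz {0} {1} {2} {3}
  obtain ⟨hnn, h0, -, hsub⟩ := hp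
  have sub (i : Fin 5) (hi : i ≠ 4) : h {i, 4} ≤ h {i} + h {4} := by
    have := hsub {i} {4}
    have := hnn ({i} ∩ {4})
    rw [Finset.insert_eq]
    linarith
  linarith [sub 0 (by decide), sub 2 (by decide), sub 3 (by decide)]

/-- A polymatroid violating the Zhang–Yeung inequality. -/
def nonZhangYeungRank (S : Finset (Fin 5)) : ℕ :=
  if S.card ≤ 1 then 2 * S.card
  else if S ∈ ({{2, 3}, {0, 2}, {0, 3}, {1, 2}, {1, 3}} : Finset (Finset (Fin 5))) then 3 else 4

/-- Monotonicity and submodularity need only these bounds by cardinality. For incomparable sets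
meeting in one point, the tight case is `4 + 2 ≤ 3 + 3`. -/
lemma nonZhangYeungRank_bounds (S : Finset (Fin 5)) :
    (S.card = 0 → nonZhangYeungRank S = 0) ∧ (S.card = 1 → nonZhangYeungRank S = 2) ∧
      (S.card = 2 → 3 ≤ nonZhangYeungRank S) ∧ (3 ≤ S.card → nonZhangYeungRank S = 4) ∧
      nonZhangYeungRank S ≤ 4 := by
  have hS : S ∈ ({{2, 3}, {0, 2}, {0, 3}, {1, 2}, {1, 3}} : Finset (Finset (Fin 5))) →
      S.card = 2 := by
    simp only [Finset.mem_insert, Finset.mem_singleton]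
    rintro (rfl | rfl | rfl | rfl | rfl) <;> rfl
  unfold nonZhangYeungRank
  split_ifs with h1 h2
  · omega
  · have := hS h2
    omega
  · omega

lemma nonZhangYeungRank_mono {X Y : Finset (Fin 5)} (h : X ⊆ Y) :
    nonZhangYeungRank X ≤ nonZhangYeungRank Y := by
  rcases h.eq_or_ssubset with rfl | h
  · exact le_rfl
  have hc := Finset.card_lt_card h
  have hX := nonZhangYeungRank_bounds X
  have hY := nonZhangYeungRank_bounds Y
  omega

lemma nonZhangYeungRank_submodular (X Y : Finset (Fin 5)) :
    nonZhangYeungRank (X ∪ Y) + nonZhangYeungRank (X ∩ Y) ≤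
      nonZhangYeungRank X + nonZhangYeungRank Y := by
  by_cases hXY : X ⊆ Y
  · rw [Finset.union_eq_right.2 hXY, Finset.inter_eq_left.2 hXY, add_comm]
  by_cases hYX : Y ⊆ X
  · rw [Finset.union_eq_left.2 hYX, Finset.inter_eq_right.2 hYX]
  have h1 : (X ∩ Y).card < X.card := Finset.card_lt_card
    ⟨Finset.inter_subset_left, fun h => hXY (h.trans Finset.inter_subset_right)⟩
  have h2 : (X ∩ Y).card < Y.card := Finset.card_lt_card
    ⟨Finset.inter_subset_right, fun h => hYX (h.trans Finset.inter_subset_left)⟩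
  have hX := nonZhangYeungRank_bounds X
  have hY := nonZhangYeungRank_bounds Y
  have hU := nonZhangYeungRank_bounds (X ∪ Y)
  have hI := nonZhangYeungRank_bounds (X ∩ Y)
  omega

lemma nonZhangYeungRank_mem_polymatroids {c : ℝ} (hc : 0 ≤ c) :
    (fun S => nonZhangYeungRank S * c) ∈ polymatroids (Fin 5) := by
  refine ⟨fun S => by positivity, by simp [nonZhangYeungRank], fun X Y hXY => ?_, fun X Y => ?_⟩
  · exact mul_le_mul_of_nonneg_right (by exact_mod_cast nonZhangYeungRank_mono hXY) hc
  · simp only [← add_mul]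
    exact mul_le_mul_of_nonneg_right (by exact_mod_cast nonZhangYeungRank_submodular X Y) hc

lemma nonZhangYeungRank_mem_HDC (hN : N ≠ 0) (hM : ((N ^ 4 : ℕ) : ℕ∞) ≤ M) :
    (fun S => nonZhangYeungRank S * Real.logb 2 N) ∈ HDC (zhangYeungPlus N M) := by
  have h4 : log2 ((N ^ 4 : ℕ) : ℕ∞) = ((4 * Real.logb 2 N : ℝ) : EReal) := by
    rw [log2_natCast (pow_ne_zero _ hN)]; simp [Real.logb_pow]
  have hu : nonZhangYeungRank Finset.univ = 4 := by decide
  have val : ∀ S ∈ ({{0, 1}, {0, 2, 3}, {1, 2, 3}, {0, 4}, {2, 4}, {3, 4}} :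
    Finset (Finset (Fin 5))), nonZhangYeungRank S = 4 := by decide
  have val' : ∀ S ∈ ({{2, 3}, {0, 2}, {0, 3}, {1, 2}, {1, 3}} :
    Finset (Finset (Fin 5))), nonZhangYeungRank S = 3 := by decide
  have val'' : nonZhangYeungRank {4} = 2 := by decide
  refine (mem_HDC_zhangYeungPlus hN (by simp [nonZhangYeungRank])).2 ⟨?_, ?_, ?_⟩
  · simp [val', val'']
  · simp [val, hu]
  · rw [hu]
    exact (by exact_mod_cast h4.ge : _ ≤ log2 ((N ^ 4 : ℕ) : ℕ∞)).trans (log2_mono hM)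

theorem edaFhtw_lt_daSubw_zhangYeungPlus (hN : 2 ≤ N) (hM : ((N ^ 4 : ℕ) : ℕ∞) ≤ M) :
    edaFhtw (zhangYeungPlus N M) < daSubw (zhangYeungPlus N M) := by
  have hN0 : N ≠ 0 := by omega
  have hlog : 0 < Real.logb 2 N := Real.logb_pos one_lt_two (by exact_mod_cast hN)
  have upper : edaFhtw (zhangYeungPlus N M) ≤ ((43 / 11 * Real.logb 2 N : ℝ) : EReal) :=
    minimaxWidth_le fun h hh => EReal.coe_le_coe_iff.2 <|
      univ_le_of_mem_HDC_zhangYeungPlus hN0 (closure_entropic_subset hh.1).1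
        (closure_entropic_subset hh.1).2 hh.2
  have lower := le_maximinWidth_of_univ_mem (Q := zhangYeungPlus N M) (by simp [zhangYeungPlus])
    (show _ ∈ polymatroids (Fin 5) ∩ _ from
      ⟨nonZhangYeungRank_mem_polymatroids hlog.le, nonZhangYeungRank_mem_HDC hN0 hM⟩)
  refine (upper.trans_lt (EReal.coe_lt_coe_iff.2 ?_)).trans_le lower
  have hu : nonZhangYeungRank Finset.univ = 4 := by decide
  rw [hu]
  push_cast
  linarith

variable {k : ℕ}

lemma edaFhtw_zhangYeungPlus_copies_le (hN : N ≠ 0) :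
    edaFhtw ((zhangYeungPlus N M).copies k) ≤
      ((k * (43 / 11 * Real.logb 2 N) : ℝ) : EReal) := by
  refine minimaxWidth_le fun h hh => EReal.coe_le_coe_iff.2 ?_
  have hc := closure_entropic_subset hh.1
  rw [← Finset.univ_product_univ]
  refine (polymatroid_prod_le_sum_layer hc.1 _).trans ?_
  refine (Finset.sum_le_card_nsmul _ _ (43 / 11 * Real.logb 2 N) fun l _ => ?_).trans (by simp)
  exact univ_le_of_mem_HDC_zhangYeungPlus hN (layer_mem_polymatroids hc.1 l)
    (layer_mem_zhangYeung hc.2 l) (mem_HDC_copies.1 hh.2 l)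

lemma le_daSubw_zhangYeungPlus_copies (hN : N ≠ 0) (hM : ((N ^ 4 : ℕ) : ℕ∞) ≤ M) :
    ((k * (4 * Real.logb 2 N) : ℝ) : EReal) ≤ daSubw ((zhangYeungPlus N M).copies k) := by
  have hlog : 0 ≤ Real.logb 2 N :=
    Real.logb_nonneg one_lt_two (by exact_mod_cast Nat.one_le_iff_ne_zero.2 hN)
  have hp := nonZhangYeungRank_mem_polymatroids hlog
  have hu : nonZhangYeungRank Finset.univ = 4 := by decide
  have lower := le_maximinWidth_of_univ_mem (Q := (zhangYeungPlus N M).copies k)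
    (by
      simp only [Query.copies, Multiset.mem_map]
      exact ⟨Finset.univ, by simp [zhangYeungPlus], Finset.univ_product_univ⟩)
    (show _ ∈ polymatroids (Fin 5 × Fin k) ∩ _ from
      ⟨sumLayers_mem_polymatroids hp, mem_HDC_copies.2 fun l => by
        rw [layer_sumLayers hp.2.1]; exact nonZhangYeungRank_mem_HDC hN hM⟩)
  rw [sumLayers_univ, hu] at lower
  exact_mod_cast lower

/-- A deliberately crude bound, used only for finiteness; the key `AC` with `S` and `W` already
gives 5 in place of 8. -/
lemma daFhtw_zhangYeungPlus_copies_le (hN : N ≠ 0) :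
    daFhtw ((zhangYeungPlus N M).copies k) ≤ ((k * (8 * Real.logb 2 N) : ℝ) : EReal) := by
  refine minimaxWidth_le fun h hh => EReal.coe_le_coe_iff.2 ?_
  rw [← Finset.univ_product_univ]
  refine (polymatroid_prod_le_sum_layer hh.1 _).trans ?_
  refine (Finset.sum_le_card_nsmul _ _ (8 * Real.logb 2 N) fun l _ => ?_).trans (by simp)
  have hp := layer_mem_polymatroids hh.1 l
  obtain ⟨⟨c1, c2, c3, c4, c5, c6⟩, ⟨k1, k2, k3, k4, k5, k6⟩, -⟩ :=
    (mem_HDC_zhangYeungPlus hN hp.2.1).1 (mem_HDC_copies.1 hh.2 l)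
  have h1 := hp.2.2.2 {0, 2} {4}
  have h2 := hp.1 ({0, 2} ∩ {4})
  have h3 := hp.2.2.1 {0, 4} ({0, 2} ∪ {4}) (by decide)
  have hlog : 0 ≤ Real.logb 2 N :=
    Real.logb_nonneg one_lt_two (by exact_mod_cast Nat.one_le_iff_ne_zero.2 hN)
  linarith

end ZhangYeungPlus

/-! ### The gaps -/

lemma boundedBy_fourCycle_copies (N k : ℕ) : ((fourCycle N).copies k).BoundedBy N :=
  Query.forall_bound_copies (p := fun b => b ≠ ⊤ → b ≤ N) <| by
    simp [fourCycle, DegreeConstraint.card]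

lemma boundedBy_zhangYeungPlus_copies (N k : ℕ) (hN : N ≠ 0) :
    ((zhangYeungPlus N ⊤).copies k).BoundedBy (N ^ 3) :=
  Query.forall_bound_copies (p := fun b => b ≠ ⊤ → b ≤ (N ^ 3 : ℕ)) <| by
    have h1 : ((N ^ 2 : ℕ) : ℕ∞) ≤ (N ^ 3 : ℕ) := by
      exact_mod_cast Nat.pow_le_pow_right (Nat.pos_of_ne_zero hN) (by norm_num)
    have h2 : (1 : ℕ∞) ≤ (N ^ 3 : ℕ) := by
      exact_mod_cast Nat.one_le_iff_ne_zero.2 (pow_ne_zero 3 hN)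
    simp only [zhangYeungPlus, DegreeConstraint.card, DegreeConstraint.fd, Set.mem_insert_iff,
      Set.mem_singleton_iff, forall_eq_or_imp, forall_eq]
    simp only [h1, h2, le_refl, implies_true, ne_eq, not_true_eq_false, false_imp_iff, and_self]

lemma Query.BoundedBy.mono {V : Type*} {Q : Query V} {N N' : ℕ} (h : Q.BoundedBy N) (hN : N ≤ N') :
    Q.BoundedBy N' :=
  fun c hc hb => (h c hc hb).trans (by exact_mod_cast hN)

end DegreeAware

open DegreeAware in
theorem mainTheorem9 :
    -- the four inequalities
    (∀ (V : Type*) [Fintype V] [DecidableEq V] (Q : Query V),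
      edaSubw Q ≤ edaFhtw Q ∧ edaFhtw Q ≤ daFhtw Q ∧
      edaSubw Q ≤ daSubw Q ∧ daSubw Q ≤ daFhtw Q) ∧
    -- incomparability: the 4-cycle
    (∀ N : ℕ, 2 ≤ N →
      edaFhtw (fourCycle N) = ((2 * Real.logb 2 N : ℝ) : EReal) ∧
      daSubw (fourCycle N) = ((3 / 2 * Real.logb 2 N : ℝ) : EReal) ∧
      daSubw (fourCycle N) < edaFhtw (fourCycle N)) ∧
    -- incomparability: the augmented Zhang–Yeung query
    (∀ (N : ℕ) (M : ℕ∞), 2 ≤ N → ((N ^ 4 : ℕ) : ℕ∞) ≤ M →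
      edaFhtw (zhangYeungPlus N M) < daSubw (zhangYeungPlus N M)) ∧
    -- all four gaps are unbounded, even for degree bounds of a fixed size
    (∃ N : ℕ, ∀ C : ℝ,
      (∃ (V : Type) (_ : Fintype V) (_ : DecidableEq V) (Q : Query V),
        Q.BoundedBy N ∧ GapAtLeast C (edaSubw Q) (edaFhtw Q)) ∧
      (∃ (V : Type) (_ : Fintype V) (_ : DecidableEq V) (Q : Query V),
        Q.BoundedBy N ∧ GapAtLeast C (edaFhtw Q) (daFhtw Q)) ∧
      (∃ (V : Type) (_ : Fintype V) (_ : DecidableEq V) (Q : Query V),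
        Q.BoundedBy N ∧ GapAtLeast C (edaSubw Q) (daSubw Q)) ∧
      (∃ (V : Type) (_ : Fintype V) (_ : DecidableEq V) (Q : Query V),
        Q.BoundedBy N ∧ GapAtLeast C (daSubw Q) (daFhtw Q))) := by
  refine ⟨fun V _ _ Q => ⟨edaSubw_le_edaFhtw Q, edaFhtw_le_daFhtw Q, edaSubw_le_daSubw Q,
    daSubw_le_daFhtw Q⟩, fun N hN => ?_, fun N M => edaFhtw_lt_daSubw_zhangYeungPlus, 8,
    fun C => ?_⟩
  · have hN0 : N ≠ 0 := by omega
    have hlog : 0 < Real.logb 2 N := Real.logb_pos one_lt_two (by exact_mod_cast hN)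
    have h1 := (fourCycleBlocks_fourCycle hN0).edaFhtw_eq
    have h2 := le_antisymm (fourCycleBlocks_fourCycle hN0).daSubw_le (le_daSubw_fourCycle hN0)
    refine ⟨h1, h2, ?_⟩
    rw [h1, h2, EReal.coe_lt_coe_iff]
    linarith
  -- At `N = 2` each copy contributes `4 - 43/11 = 1/11` to a Zhang–Yeung gap and `1/2` to a cycle
  -- gap. The uniform degree bound `8` is `2 ^ 3`; with `M = ⊤` the full atom adds no finite bound.
  · obtain ⟨k, hk⟩ := exists_nat_ge (11 * |C|)
    have hC := le_abs_self C
    have hC0 := abs_nonneg C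
    have hlog : Real.logb 2 (2 : ℕ) = 1 := by simp
    have H := fourCycleBlocks_copies two_ne_zero k
    have hc0 : 0 ≤ edaSubw ((fourCycle 2).copies k) :=
      zero_le_edaSubw <| Query.forall_bound_copies (p := (· ≠ 0)) <| by
        simp [fourCycle, DegreeConstraint.card]
    have hz0 : 0 ≤ edaSubw ((zhangYeungPlus 2 ⊤).copies k) :=
      zero_le_edaSubw <| Query.forall_bound_copies (p := (· ≠ 0)) <| by
        simp [zhangYeungPlus, DegreeConstraint.card, DegreeConstraint.fd]
    have hcb := (boundedBy_fourCycle_copies 2 k).mono (show 2 ≤ 8 by norm_num)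
    have hzb := boundedBy_zhangYeungPlus_copies 2 k two_ne_zero
    have z1 := edaFhtw_zhangYeungPlus_copies_le (M := ⊤) (k := k) two_ne_zero
    have z2 := le_daSubw_zhangYeungPlus_copies (M := ⊤) (k := k) two_ne_zero le_top
    have z3 := daFhtw_zhangYeungPlus_copies_le (M := ⊤) (k := k) two_ne_zero
    refine ⟨⟨_, inferInstance, inferInstance, _, hcb, ?_⟩,
      ⟨_, inferInstance, inferInstance, _, hzb, ?_⟩,
      ⟨_, inferInstance, inferInstance, _, hzb, ?_⟩,
      ⟨_, inferInstance, inferInstance, _, hcb, ?_⟩⟩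
    · exact .of_bounds hc0 ((edaSubw_le_daSubw _).trans H.daSubw_le) H.le_edaFhtw
        ((edaFhtw_le_daFhtw _).trans H.daFhtw_le) (by rw [hlog]; linarith)
    · exact .of_bounds (hz0.trans (edaSubw_le_edaFhtw _)) z1 (z2.trans (daSubw_le_daFhtw _)) z3
        (by rw [hlog]; linarith)
    · exact .of_bounds hz0 ((edaSubw_le_edaFhtw _).trans z1) z2
        ((daSubw_le_daFhtw _).trans z3) (by rw [hlog]; linarith)
    · exact .of_bounds (hc0.trans (edaSubw_le_daSubw _)) H.daSubw_le
        (H.le_edaFhtw.trans (edaFhtw_le_daFhtw _)) H.daFhtw_le (by rw [hlog]; linarith)
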